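/- Let $N\ge 1$, $N_b\ge 1$, and for fermions let also $N<N_b$. Let $\mathcal H_\pm^N$ be the space of symmetric ($+$, bosons) resp. antisymmetric ($-$, fermions) tensors of order $N$ over $\mathbb C^{N_b}$, with annihilation operators $a_i$, creation operators $a_i^\dagger$, $1\le i\le N_b$, and let $\mathcal D$ be the set of density-matrix operators on it: self-adjoint $\hat\rho\ge 0$ with $\mathrm{Tr}\,\hat\rho=1$. The 1RDM of $\hat\rho$ is the matrix $\gamma_{ij}[\hat\rho]=\mathrm{Tr}\{\hat\rho\, a_j^\dagger a_i\}$, and one writes $\hat\rho\to\gamma$ if $\gamma[\hat\rho]=\gamma$. Let $\hat H_0$ be any self-adjoint operator on $\mathcal H_\pm^N$, let $\beta>0$, and let $\mathcal V$ be the real vector space of Hermitian $N_b\times N_b$ matrices of trace zero. For $v\in\mathcal V$ put $\hat H_v=\hat H_0+\sum_{i,j}v_{ij}a_i^\dagger a_j$, with Gibbs state $\hat\rho_v=e^{-\beta\hat H_v}/\mathrm{Tr}\{e^{-\beta\hat H_v}\}$ and 1RDM $\gamma_v=\gamma[\hat\rho_v]$. Put $$\overline{\mathscr N}_{N,+}=\{\gamma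 \text{ Hermitian } N_b\times N_b:\ \gamma\ge 0,\ \mathrm{tr}\,\gamma=N\},\qquad \overline{\mathscr N}_{N,-}=\{\gamma\in\overline{\mathscr N}_{N,+}:\ \gamma^2\le\gamma\},$$ $$\mathscr N_{N,+}=\{\gamma \text{ Hermitian } N_b\times N_b:\ \gamma> 0,\ \mathrm{tr}\,\gamma=N\},\qquad \mathscr N_{N,-}=\{\gamma\in\mathscr N_{N,+}:\ \gamma^2<\gamma\},$$ where $A<B$ means that $B-A$ is positive definite. A 1RDM $\gamma\in\overline{\mathscr N}_{N,\pm}$ is called $v$-representable if $\gamma=\gamma_v$ for some $v\in\mathcal V$. The universal functional is $$F_{N,\pm}[\gamma]=\inf_{\hat\rho\in\mathcal D,\ \hat\rho\to\gamma}\mathrm{Tr}\{\hat\rho(\hat H_0+\beta^{-1}\log\hat\rho)\}\in(-\infty,\infty],$$ with value $\infty$ if no $\hat\rho\to\gamma$ exists, and with $0\log 0=0$. Then: (i) $\mathscr N_{N,\pm}$ is equal to the set of $v$-representable 1RDMs. (ii) $F_{N,\pm}$ is differentiable on $\mathscr N_{N,\pm}$ in the trace-zero directions: for every $\gamma\in\mathscr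 N_{N,\pm}$ the function $h\mapsto F_{N,\pm}[\gamma+h]$ is finite for all $h\in\mathcal V$ near $0$, and there is a linear map $J:\mathcal V\to\mathbb R$ with $$\lim_{\mathcal V\ni h\to 0}\frac{|F_{N,\pm}[\gamma+h]-F_{N,\pm}[\gamma]-J(h)|}{\|h\|}=0.$$ Its derivative is $-v$: if $v\in\mathcal V$ and $\gamma=\gamma_v$, then $J(h)=-\mathrm{tr}(vh)$ for all $h\in\mathcal V$. -/

import Mathlib

/-! Canonical one-body reduced density-matrix functional theory in a finite basis set. -/

noncomputable section

namespace RDMFT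

open scoped Topology ComplexOrder

/-- The two kinds of particle statistics. -/
inductive Statistics where
  | boson
  | fermion

/-- The sign picked up under a permutation: trivial for bosons, the signature for fermions. -/
def Statistics.phase {N : ℕ} : Statistics → Equiv.Perm (Fin N) → ℤ
  | .boson, _ => 1
  | .fermion, σ => (Equiv.Perm.sign σ : ℤ)

/-- The `N`-particle Hilbert space over the one-particle space `ℂ ^ Nb`: the symmetric (bosons) or
antisymmetric (fermions) tensors of order `N`. A tensor is given by its coefficients in the
orthonormal product basis of the tensor power, indexed by `Fin N → Fin Nb`. -/
def particleSpace (s : Statistics) (Nb N : ℕ) :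
    Submodule ℂ (EuclideanSpace ℂ (Fin N → Fin Nb)) where
  carrier := {ψ | ∀ (σ : Equiv.Perm (Fin N)) (x : Fin N → Fin Nb),
    ψ (x ∘ σ) = (s.phase σ : ℂ) * ψ x}
  zero_mem' := by intro σ x; simp
  add_mem' := by
    intro ψ φ hψ hφ σ x
    simp [hψ σ x, hφ σ x, mul_add]
  smul_mem' := by
    intro c ψ hψ σ x
    simp [hψ σ x, mul_left_comm]

/-- The `N`-particle space as a type, a finite-dimensional Hilbert space with the inner product
of the tensor power. -/
def NParticle (s : Statistics) (Nb N : ℕ) : Type := particleSpace s Nb N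

instance (s : Statistics) (Nb N : ℕ) : NormedAddCommGroup (NParticle s Nb N) :=
  inferInstanceAs (NormedAddCommGroup (particleSpace s Nb N))

instance (s : Statistics) (Nb N : ℕ) : InnerProductSpace ℂ (NParticle s Nb N) :=
  inferInstanceAs (InnerProductSpace ℂ (particleSpace s Nb N))

instance (s : Statistics) (Nb N : ℕ) : FiniteDimensional ℂ (NParticle s Nb N) :=
  inferInstanceAs (FiniteDimensional ℂ (particleSpace s Nb N))

instance (s : Statistics) (Nb N : ℕ) : CompleteSpace (NParticle s Nb N) :=
  FiniteDimensional.complete ℂ (NParticle s Nb N)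

/-- Operators on the `N`-particle space. -/
abbrev Operator (s : Statistics) (Nb N : ℕ) := NParticle s Nb N →L[ℂ] NParticle s Nb N

/-- Operators on the one-particle space `ℂ ^ Nb`, written as matrices. -/
abbrev OneBody (Nb : ℕ) := Matrix (Fin Nb) (Fin Nb) ℂ

theorem annihilation_mem {s : Statistics} {Nb n : ℕ} (i : Fin Nb)
    (ψ : particleSpace s Nb (n + 1)) :
    WithLp.toLp 2 (fun x : Fin n → Fin Nb =>
      (Real.sqrt (n + 1) : ℂ) * ψ.1 (Fin.cons i x : Fin (n + 1) → Fin Nb)) ∈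
      particleSpace s Nb n := by
  intro σ x
  have h := ψ.2 (Equiv.Perm.decomposeFin.symm (0, σ)) (Fin.cons i x : Fin (n + 1) → Fin Nb)
  have e : (Fin.cons i x : Fin (n + 1) → Fin Nb) ∘ (Equiv.Perm.decomposeFin.symm (0, σ)) =
      (Fin.cons i (x ∘ σ) : Fin (n + 1) → Fin Nb) := by
    funext k
    refine Fin.cases ?_ (fun k => ?_) k <;> simp
  have p : s.phase (Equiv.Perm.decomposeFin.symm ((0 : Fin (n + 1)), σ)) = s.phase σ := by
    cases s <;> simp [Statistics.phase]
  rw [e, p] at h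
  simp only [h]
  ring

/-- The annihilation operator `a i` from `n + 1` particles to `n` particles:
`(a i ψ)(x₁, …, xₙ) = √(n + 1) ψ(i, x₁, …, xₙ)`. -/
def annihilation (s : Statistics) (Nb n : ℕ) (i : Fin Nb) :
    NParticle s Nb (n + 1) →L[ℂ] NParticle s Nb n :=
  LinearMap.toContinuousLinearMap (E := NParticle s Nb (n + 1)) (F' := NParticle s Nb n)
    (show particleSpace s Nb (n + 1) →ₗ[ℂ] particleSpace s Nb n from
    { toFun := fun ψ => ⟨_, annihilation_mem i ψ⟩
      map_add' := by
        intro ψ φ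
        ext x
        simp [mul_add]
      map_smul' := by
        intro c ψ
        ext x
        simp [mul_left_comm] })

/-- The operator `a† i ∘ a j` on the `N`-particle space, where the creation operator `a† i` is the
adjoint of `a i`. It vanishes on the space without particles. -/
def hopping (s : Statistics) (Nb : ℕ) : (N : ℕ) → Fin Nb → Fin Nb → Operator s Nb N
  | 0, _, _ => 0
  | n + 1, i, j =>
    (ContinuousLinearMap.adjoint (annihilation s Nb n i)).comp (annihilation s Nb n j)

variable {s : Statistics} {Nb N : ℕ}

/-- The trace over the `N`-particle space. -/
def Tr (A : Operator s Nb N) : ℂ :=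
  LinearMap.trace ℂ (NParticle s Nb N) A.toLinearMap

/-- The density-matrix operators (`IsPositive` means self-adjoint and positive semidefinite). -/
def densityOperators (s : Statistics) (Nb N : ℕ) : Set (Operator s Nb N) :=
  {ρ | ρ.IsPositive ∧ Tr ρ = 1}

/-- The one-body reduced density matrix `γ i j = Tr (ρ a†_j a_i)`. -/
def rdm (ρ : Operator s Nb N) : OneBody Nb :=
  Matrix.of fun i j => Tr (ρ * hopping s Nb N j i)

/-- The operator on the `N`-particle space that belongs to the (non-local) potential `v`. -/
def potential (s : Statistics) (N : ℕ) (v : OneBody Nb) : Operator s Nb N :=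
  ∑ i, ∑ j, v i j • hopping s Nb N i j

/-- The Hamiltonian with kinetic and interaction part `H₀` and potential `v`. -/
def hamiltonian (H₀ : Operator s Nb N) (v : OneBody Nb) : Operator s Nb N :=
  H₀ + potential s N v

/-- The entropy `-Tr (ρ log ρ)`, with `0 log 0 = 0`. -/
def entropy (ρ : Operator s Nb N) : ℝ :=
  (Tr (cfc Real.negMulLog ρ)).re

/-- The Helmholtz functional at potential `v` and inverse temperature `β`. -/
def helmholtz (H₀ : Operator s Nb N) (β : ℝ) (v : OneBody Nb) (ρ : Operator s Nb N) : ℝ :=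
  (Tr (ρ * hamiltonian H₀ v)).re - β⁻¹ * entropy ρ

/-- The Gibbs state `exp (-β H_v) / Tr (exp (-β H_v))`. -/
def gibbs (H₀ : Operator s Nb N) (β : ℝ) (v : OneBody Nb) : Operator s Nb N :=
  (Tr (NormedSpace.exp (-(β : ℂ) • hamiltonian H₀ v)))⁻¹ •
    NormedSpace.exp (-(β : ℂ) • hamiltonian H₀ v)

/-- The trace-zero Hermitian matrices: both the admissible potentials and the directions in which
the one-body reduced density matrices vary. -/
def traceless (Nb : ℕ) : Submodule ℝ (OneBody Nb) where
  carrier := {v | v.IsHermitian ∧ v.trace = 0}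
  zero_mem' := ⟨Matrix.isHermitian_zero, Matrix.trace_zero _ _⟩
  add_mem' := by
    rintro a b ⟨ha, ha'⟩ ⟨hb, hb'⟩
    exact ⟨ha.add hb, by rw [Matrix.trace_add, ha', hb', add_zero]⟩
  smul_mem' := by
    rintro c a ⟨ha, ha'⟩
    refine ⟨?_, by rw [Matrix.trace_smul, ha', smul_zero]⟩
    rw [Matrix.IsHermitian, Matrix.conjTranspose_smul, ha.eq, star_trivial]

/-- All `N`-representable one-body reduced density matrices: Hermitian, `γ ≥ 0`, trace `N`, and
`γ² ≤ γ` for fermions. -/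
def closedRDMs (s : Statistics) (Nb N : ℕ) : Set (OneBody Nb) :=
  {γ | γ.PosSemidef ∧ γ.trace = N ∧
    match s with
    | .boson => True
    | .fermion => (γ - γ * γ).PosSemidef}

/-- The one-body reduced density matrices with purely fractional spectrum: Hermitian, `γ > 0`,
trace `N`, and `γ² < γ` for fermions. -/
def fractionalRDMs (s : Statistics) (Nb N : ℕ) : Set (OneBody Nb) :=
  {γ | γ.PosDef ∧ γ.trace = N ∧
    match s with
    | .boson => True
    | .fermion => (γ - γ * γ).PosDef}

/-- The `v`-representable one-body reduced density matrices: those of the Gibbs states. -/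
def vRepresentable (H₀ : Operator s Nb N) (β : ℝ) : Set (OneBody Nb) :=
  {γ | γ ∈ closedRDMs s Nb N ∧ ∃ v ∈ traceless Nb, rdm (gibbs H₀ β v) = γ}

/-- The universal functional: the infimum of the Helmholtz functional at zero potential over the
density-matrix operators that generate `γ`, and `⊤` if there are none. -/
def universalFunctional (H₀ : Operator s Nb N) (β : ℝ) (γ : OneBody Nb) : EReal :=
  ⨅ ρ ∈ {ρ : Operator s Nb N | ρ ∈ densityOperators s Nb N ∧ rdm ρ = γ},
    ((helmholtz H₀ β 0 ρ : ℝ) : EReal)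

attribute [local instance] Matrix.frobeniusNormedAddCommGroup Matrix.frobeniusNormedSpace

/-- `F` is finite near `γ` in the trace-zero directions and has Fréchet derivative `J` there. -/
def HasDerivAlong (F : OneBody Nb → EReal) (J : traceless Nb →L[ℝ] ℝ) (γ : OneBody Nb) : Prop :=
  (∀ᶠ h : traceless Nb in 𝓝 0, F (γ + h) ≠ ⊤ ∧ F (γ + h) ≠ ⊥) ∧
    HasFDerivAt (fun h : traceless Nb => (F (γ + h)).toReal) J 0

/-- The linear functional `h ↦ tr (w h)` on the trace-zero Hermitian matrices; it is real-valued
when `w` is Hermitian. -/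
def tracePairing (w : OneBody Nb) : traceless Nb →L[ℝ] ℝ :=
  LinearMap.toContinuousLinearMap
    { toFun := fun h => (w * (h : OneBody Nb)).trace.re
      map_add' := by
        intro a b
        simp [Matrix.mul_add]
      map_smul' := by
        intro c a
        simp }

end RDMFT

end

/-! Write Ω(v) = -β⁻¹ log Tr exp(-βH_v). By the Gibbs variational principle, Ω(v) is the minimum of
the Helmholtz functional at v, attained only at the Gibbs state (`helmholtz_sub_freeEnergy`,
`freeEnergy_le`, `eq_thermalState_of_le`). Since v enters that functional only through tr(vγ), γ_v
is a supergradient of Ω at v (`freeEnergy_le_add`). Moreover F[γ] ≥ Ω(v) - tr(vγ) for every v, with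
equality at γ = γ_v.

Gibbs 1RDMs are fractional because a Gibbs state is strictly positive: the number operator n_z of an
orbital z and, for fermions, |z|² - n_z are nonzero and nonnegative, so their expectations are
positive (`rdm_mem_fractionalRDMs`). That they are nonzero rests on
`eq_smul_one_of_potential_eq_smul_one`.

Conversely, for fractional γ the function tr(vγ) - Ω(v) is coercive: filling the N lowest levels of
v gives a potential energy below tr(vγ) by a multiple of the size of v (`exists_lowest_filling`,
`freeEnergy_coercive`). A minimiser v exists, and the supergradient inequality along rays forces γ_v
= γ (`exists_rdm_gibbs_eq`).

For the derivative, let γ = γ_v and γ + h = γ_w. The supergradient inequalities at v and w give 0 ≤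
F[γ+h] - F[γ] + tr(vh) ≤ tr((v-w)h). It remains that w → v as h → 0; this follows by compactness
from injectivity of v ↦ γ_v (`rdm_gibbs_injective`) and the bound of `norm_le_of_rdm_gibbs_eq`
(`eventually_entrySum_sub_lt`). -/

noncomputable section

namespace RDMFT

open scoped Topology ComplexOrder

/-! ### Functional calculus and eigenbases in finite dimension. -/

section Spectral

variable {E : Type*} [NormedAddCommGroup E] [InnerProductSpace ℂ E]

theorem aeval_apply_of_eigenvector (A : E →L[ℂ] E) (q : Polynomial ℝ) {a : ℝ} {e : E}
    (h : A e = (a : ℂ) • e) : Polynomial.aeval A q e = ((q.eval a : ℝ) : ℂ) • e := by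
  have hp : ∀ n : ℕ, (A ^ n) e = ((a ^ n : ℝ) : ℂ) • e := by
    intro n
    induction n with
    | zero => simp
    | succ n ih =>
      rw [pow_succ', mul_apply_eq_comp, ih, map_smul, h, smul_smul]
      congr 1; push_cast; ring
  induction q using Polynomial.induction_on' with
  | add p q hp hq => simp [hp, hq, add_smul]
  | monomial n c =>
    rw [Polynomial.aeval_monomial, Polynomial.eval_monomial, mul_apply_eq_comp, hp,
      Algebra.algebraMap_eq_smul_one, smul_apply,
      one_apply_eq_self, ← Complex.coe_smul, smul_smul]
    push_cast; rfl

variable [FiniteDimensional ℂ E]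

theorem finite_real_spectrum (A : E →L[ℂ] E) : (spectrum ℝ A).Finite := by
  have h : (spectrum ℂ A).Finite := by
    have := Module.End.finite_spectrum (K := ℂ) ((Module.End.toContinuousLinearMap E).symm A)
    rwa [AlgEquiv.spectrum_eq] at this
  rw [← spectrum.preimage_algebraMap ℂ]
  exact h.preimage (FaithfulSMul.algebraMap_injective ℝ ℂ).injOn

variable [CompleteSpace E]

/-- The spectrum is finite, so f may be replaced by a Lagrange interpolant. Adding a to the nodes
avoids proving that it lies in the spectrum, and so covers e = 0. -/
theorem cfc_apply_of_eigenvector {A : E →L[ℂ] E} (hA : IsSelfAdjoint A) (f : ℝ → ℝ) {a : ℝ}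
    {e : E} (h : A e = (a : ℂ) • e) : cfc f A e = (f a : ℂ) • e := by
  classical
  set S : Finset ℝ := insert a (finite_real_spectrum A).toFinset
  set q := Lagrange.interpolate S id f
  have hq : ∀ x ∈ S, q.eval x = f x := fun x hx =>
    Lagrange.eval_interpolate_at_node (v := id) f Function.injective_id.injOn hx
  have hc : cfc f A = Polynomial.aeval A q := by
    rw [← cfc_polynomial q A]
    refine cfc_congr fun x hx => ?_
    rw [hq x (by simp [S, hx])]
  rw [hc, aeval_apply_of_eigenvector A q h, hq a (by simp [S])]

theorem exists_eigenbasis {A : E →L[ℂ] E} (hA : IsSelfAdjoint A) :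
    ∃ (b : OrthonormalBasis (Fin (Module.finrank ℂ E)) ℂ E)
      (l : Fin (Module.finrank ℂ E) → ℝ), ∀ i, A (b i) = (l i : ℂ) • b i := by
  have hs : (A : E →ₗ[ℂ] E).IsSymmetric := hA.isSymmetric
  exact ⟨hs.eigenvectorBasis rfl, hs.eigenvalues rfl, fun i => hs.apply_eigenvectorBasis rfl i⟩

end Spectral

/-! ### Relative entropy and the Gibbs variational principle. -/

/-- This is log x ≤ x - 1 at x = q/p, times p. The terms -p + q make each summand of the relative
entropy nonnegative on its own; they cancel when summed over probabilities. -/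
theorem relEntropy_term_nonneg {p q : ℝ} (hp : 0 ≤ p) (hq : 0 < q) :
    0 ≤ -Real.negMulLog p - p * Real.log q - p + q := by
  rcases hp.eq_or_lt with rfl | hp
  · simpa using hq.le
  · have h := Real.log_le_sub_one_of_pos (div_pos hq hp)
    rw [Real.log_div hq.ne' hp.ne'] at h
    have : p * (Real.log q - Real.log p) ≤ p * (q / p - 1) := by gcongr
    have h2 : p * (q / p - 1) = q - p := by field_simp
    simp only [Real.negMulLog]
    linarith

theorem relEntropy_term_eq_zero {p q : ℝ} (hp : 0 ≤ p) (hq : 0 < q)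
    (h0 : -Real.negMulLog p - p * Real.log q - p + q = 0) : p = q := by
  rcases hp.eq_or_lt with rfl | hp
  · simp at h0; exact h0.symm
  · by_contra hne
    have h := Real.log_lt_sub_one_of_pos (div_pos hq hp)
      (fun h => hne ((div_eq_one_iff_eq hp.ne').1 h).symm)
    rw [Real.log_div hq.ne' hp.ne'] at h
    have : p * (Real.log q - Real.log p) < p * (q / p - 1) := by gcongr
    have h2 : p * (q / p - 1) = q - p := by field_simp
    simp only [Real.negMulLog] at h0
    linarith

variable {s : Statistics} {Nb N : ℕ}

theorem Tr_eq_sum_inner {ι : Type*} [Fintype ι] (b : OrthonormalBasis ι ℂ (NParticle s Nb N))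
    (A : Operator s Nb N) : Tr A = ∑ i, inner ℂ (b i) (A (b i)) :=
  LinearMap.trace_eq_sum_inner A.toLinearMap b

theorem Tr_eq_sum_of_eigenbasis {ι : Type*} [Fintype ι]
    (b : OrthonormalBasis ι ℂ (NParticle s Nb N))
    {A : Operator s Nb N} {l : ι → ℝ} (h : ∀ i, A (b i) = (l i : ℂ) • b i) :
    Tr A = ((∑ i, l i : ℝ) : ℂ) := by
  rw [Tr_eq_sum_inner b]
  simp [h]

theorem Tr_smul (c : ℂ) (A : Operator s Nb N) : Tr (c • A) = c * Tr A := by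
  simp [Tr]

theorem Tr_add (A B : Operator s Nb N) : Tr (A + B) = Tr A + Tr B := by
  simp [Tr]

theorem Tr_sum {ι : Type*} (t : Finset ι) (A : ι → Operator s Nb N) :
    Tr (∑ i ∈ t, A i) = ∑ i ∈ t, Tr (A i) := by
  classical
  induction t using Finset.induction_on with
  | empty => simp [Tr]
  | insert a t ha ih => rw [Finset.sum_insert ha, Finset.sum_insert ha, Tr_add, ih]

theorem Tr_mul_comm (A B : Operator s Nb N) : Tr (A * B) = Tr (B * A) :=
  LinearMap.trace_mul_comm ℂ A.toLinearMap B.toLinearMap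

theorem continuous_Tr : Continuous (Tr : Operator s Nb N → ℂ) := by
  let L : Operator s Nb N →ₗ[ℂ] ℂ :=
    { toFun := Tr, map_add' := Tr_add, map_smul' := Tr_smul }
  exact L.continuous_of_finiteDimensional

/-- The thermal state of a general Hamiltonian `H`. -/
def thermalState (β : ℝ) (H : Operator s Nb N) : Operator s Nb N :=
  (Tr (NormedSpace.exp (-(β : ℂ) • H)))⁻¹ • NormedSpace.exp (-(β : ℂ) • H)

/-- The canonical free energy `-β⁻¹ log Tr exp (-β H)`. -/
def freeEnergy (β : ℝ) (H : Operator s Nb N) : ℝ :=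
  -β⁻¹ * Real.log (Tr (NormedSpace.exp (-(β : ℂ) • H))).re

theorem isSelfAdjoint_neg_smul (β : ℝ) {H : Operator s Nb N} (hH : IsSelfAdjoint H) :
    IsSelfAdjoint (-(β : ℂ) • H) := by
  refine IsSelfAdjoint.smul ?_ hH
  simp [isSelfAdjoint_iff]

theorem exp_apply_of_eigenvector (β : ℝ) {H : Operator s Nb N} (hH : IsSelfAdjoint H) {a : ℝ}
    {e : NParticle s Nb N} (h : H e = (a : ℂ) • e) :
    NormedSpace.exp (-(β : ℂ) • H) e = (Real.exp (-β * a) : ℂ) • e := by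
  have hs := isSelfAdjoint_neg_smul β hH
  rw [← CFC.real_exp_eq_normedSpace_exp hs]
  refine cfc_apply_of_eigenvector hs Real.exp ?_
  rw [smul_apply, h, smul_smul]
  push_cast; rfl

section Gibbs

variable {ι : Type*} [Fintype ι] {β : ℝ} {H : Operator s Nb N}

theorem Tr_exp_eq (hH : IsSelfAdjoint H) (f : OrthonormalBasis ι ℂ (NParticle s Nb N)) {h : ι → ℝ}
    (hf : ∀ j, H (f j) = (h j : ℂ) • f j) :
    Tr (NormedSpace.exp (-(β : ℂ) • H)) = ((∑ j, Real.exp (-β * h j) : ℝ) : ℂ) :=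
  Tr_eq_sum_of_eigenbasis f fun j => exp_apply_of_eigenvector β hH (hf j)

theorem thermalState_apply (hH : IsSelfAdjoint H) (f : OrthonormalBasis ι ℂ (NParticle s Nb N))
    {h : ι → ℝ} (hf : ∀ j, H (f j) = (h j : ℂ) • f j) (j : ι) :
    thermalState β H (f j) =
      ((Real.exp (-β * h j) / ∑ k, Real.exp (-β * h k) : ℝ) : ℂ) • f j := by
  rw [thermalState, smul_apply, exp_apply_of_eigenvector β hH (hf j),
    Tr_exp_eq hH f hf, smul_smul]
  congr 1
  push_cast
  ring

end Gibbs

theorem isSelfAdjoint_thermalState (β : ℝ) {H : Operator s Nb N} (hH : IsSelfAdjoint H) :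
    IsSelfAdjoint (thermalState β H) := by
  obtain ⟨f, h, hf⟩ := exists_eigenbasis hH
  refine IsSelfAdjoint.smul ?_ ?_
  · rw [Tr_exp_eq hH f hf, isSelfAdjoint_iff,
      ← Complex.ofReal_inv, Complex.star_def, Complex.conj_ofReal]
  · rw [← CFC.real_exp_eq_normedSpace_exp (isSelfAdjoint_neg_smul β hH)]
    exact cfc_predicate _ _

theorem sum_exp_pos {ι : Type*} [Fintype ι] [Nonempty ι] (g : ι → ℝ) :
    0 < ∑ j, Real.exp (g j) :=
  Finset.sum_pos (fun _ _ => Real.exp_pos _) Finset.univ_nonempty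

theorem re_inner_apply_eq_sum {ι : Type*} [Fintype ι] (b : OrthonormalBasis ι ℂ (NParticle s Nb N))
    {A : Operator s Nb N} {l : ι → ℝ} (h : ∀ i, A (b i) = (l i : ℂ) • b i)
    (x : NParticle s Nb N) :
    inner ℂ x (A x) = ((∑ i, l i * ‖inner ℂ (b i) x‖ ^ 2 : ℝ) : ℂ) := by
  conv_lhs => rw [← b.sum_repr x, map_sum, inner_sum]
  push_cast
  refine Finset.sum_congr rfl fun i _ => ?_
  rw [map_smul, h, inner_smul_right, inner_smul_right, b.sum_repr, b.repr_apply_apply,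
    ← inner_conj_symm x (b i), ← Complex.mul_conj']
  ring

/-- The constant is the least Boltzmann weight. This strict positivity is what keeps the occupations
away from their extreme values. -/
theorem thermalState_pos [Nontrivial (NParticle s Nb N)] (β : ℝ) {H : Operator s Nb N}
    (hH : IsSelfAdjoint H) : ∃ c : ℝ, 0 < c ∧ ∀ x : NParticle s Nb N,
      c * ‖x‖ ^ 2 ≤ (inner ℂ x (thermalState β H x)).re := by
  obtain ⟨f, h, hf⟩ := exists_eigenbasis hH
  have : Nonempty (Fin (Module.finrank ℂ (NParticle s Nb N))) :=
    ⟨⟨0, Module.finrank_pos⟩⟩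
  have hZ := sum_exp_pos fun k => -β * h k
  set q := fun j => Real.exp (-β * h j) / ∑ k, Real.exp (-β * h k)
  obtain ⟨j₀, hj₀⟩ := Finite.exists_min q
  refine ⟨q j₀, div_pos (Real.exp_pos _) hZ, fun x => ?_⟩
  rw [re_inner_apply_eq_sum f (thermalState_apply hH f hf) x, Complex.ofReal_re,
    ← f.sum_sq_norm_inner_right, Finset.mul_sum]
  exact Finset.sum_le_sum fun i _ => mul_le_mul_of_nonneg_right (hj₀ i) (by positivity)

theorem thermalState_mem [Nontrivial (NParticle s Nb N)] (β : ℝ) {H : Operator s Nb N}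
    (hH : IsSelfAdjoint H) : thermalState β H ∈ densityOperators s Nb N := by
  refine ⟨?_, ?_⟩
  · obtain ⟨c, hc, h⟩ := thermalState_pos β hH
    refine ContinuousLinearMap.isPositive_def'.2 ⟨isSelfAdjoint_thermalState β hH, fun x => ?_⟩
    have h2 : 0 ≤ (inner ℂ x (thermalState β H x)).re := le_trans (by positivity) (h x)
    rwa [ContinuousLinearMap.reApplyInnerSelf_apply, ← inner_conj_symm, RCLike.conj_re]
  · obtain ⟨f, h, hf⟩ := exists_eigenbasis hH
    have : Nonempty (Fin (Module.finrank ℂ (NParticle s Nb N))) :=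
      ⟨⟨0, Module.finrank_pos⟩⟩
    have hZ := sum_exp_pos fun k => -β * h k
    rw [thermalState, Tr_smul, Tr_exp_eq hH f hf, inv_mul_cancel₀]
    exact_mod_cast hZ.ne'

/-- The excess of the Helmholtz functional over the free energy is a relative entropy. -/
theorem helmholtz_sub_freeEnergy [Nontrivial (NParticle s Nb N)] {β : ℝ} (hβ : 0 < β)
    {H ρ : Operator s Nb N} (hH : IsSelfAdjoint H) (hρ : IsSelfAdjoint ρ) (hT : Tr ρ = 1)
    {ι : Type*} [Fintype ι] {e f : OrthonormalBasis ι ℂ (NParticle s Nb N)} {p h : ι → ℝ}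
    (he : ∀ i, ρ (e i) = (p i : ℂ) • e i) (hf : ∀ j, H (f j) = (h j : ℂ) • f j)
    {q : ι → ℝ} (hq : ∀ j, q j = Real.exp (-β * h j) / ∑ k, Real.exp (-β * h k)) :
    β * ((Tr (ρ * H)).re - β⁻¹ * entropy ρ - freeEnergy β H) =
      ∑ i, ∑ j, ‖inner ℂ (e i) (f j)‖ ^ 2 *
        (-Real.negMulLog (p i) - p i * Real.log (q j) - p i + q j) := by
  have : Nonempty ι := by
    by_contra hne
    rw [not_nonempty_iff] at hne
    rw [Tr_eq_sum_of_eigenbasis e he] at hT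
    simp at hT
  have hZ := sum_exp_pos fun k => -β * h k
  set Z := ∑ k, Real.exp (-β * h k)
  have hp1 : ∑ i, p i = 1 := by
    rw [Tr_eq_sum_of_eigenbasis e he] at hT
    exact_mod_cast hT
  have hq1 : ∑ j, q j = 1 := by
    simp only [hq]
    rw [← Finset.sum_div, div_self hZ.ne']
  -- By Parseval the squared overlaps form a doubly stochastic matrix, so terms depending on only
  -- one of the two indices reduce to single sums.
  have hr : ∀ i, ∑ j, ‖inner ℂ (e i) (f j)‖ ^ 2 = 1 := by
    intro i
    have := f.sum_sq_norm_inner_left (e i)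
    simpa using this
  have hc : ∀ j, ∑ i, ‖inner ℂ (e i) (f j)‖ ^ 2 = 1 := by
    intro j
    have := e.sum_sq_norm_inner_right (f j)
    simpa using this
  have hS : entropy ρ = ∑ i, Real.negMulLog (p i) := by
    rw [entropy, Tr_eq_sum_of_eigenbasis e fun i => cfc_apply_of_eigenvector hρ _ (he i),
      Complex.ofReal_re]
  have hE : (Tr (ρ * H)).re = ∑ i, ∑ j, ‖inner ℂ (e i) (f j)‖ ^ 2 * (p i * h j) := by
    rw [Tr_mul_comm, Tr_eq_sum_inner e, Complex.re_sum]
    refine Finset.sum_congr rfl fun i _ => ?_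
    rw [mul_apply_eq_comp, he, map_smul, inner_smul_right,
      re_inner_apply_eq_sum f hf, ← Complex.ofReal_mul, Complex.ofReal_re, Finset.mul_sum]
    refine Finset.sum_congr rfl fun j _ => ?_
    rw [norm_inner_symm]
    ring
  have hF : β * freeEnergy β H = -Real.log Z := by
    rw [freeEnergy, Tr_exp_eq hH f hf, Complex.ofReal_re, ← mul_assoc, mul_neg,
      mul_inv_cancel₀ hβ.ne', neg_one_mul]
  have hl : ∀ j, Real.log (q j) = -β * h j - Real.log Z := by
    intro j
    rw [hq, Real.log_div (Real.exp_pos _).ne' hZ.ne', Real.log_exp]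
  have e1 : ∑ i, ∑ j, ‖inner ℂ (e i) (f j)‖ ^ 2 *
        (-Real.negMulLog (p i) - p i * Real.log (q j) - p i + q j) =
      ∑ i, (∑ j, ‖inner ℂ (e i) (f j)‖ ^ 2) *
        (-Real.negMulLog (p i) + p i * Real.log Z - p i) +
      β * ∑ i, ∑ j, ‖inner ℂ (e i) (f j)‖ ^ 2 * (p i * h j) +
      ∑ j, (∑ i, ‖inner ℂ (e i) (f j)‖ ^ 2) * q j := by
    simp only [Finset.sum_mul, Finset.mul_sum]
    rw [Finset.sum_comm (s := Finset.univ) (t := Finset.univ)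
      (f := fun j i => ‖inner ℂ (e i) (f j)‖ ^ 2 * q j)]
    simp only [← Finset.sum_add_distrib]
    refine Finset.sum_congr rfl fun i _ => Finset.sum_congr rfl fun j _ => ?_
    rw [hl]
    ring
  have e2 : ∑ i, (∑ j, ‖inner ℂ (e i) (f j)‖ ^ 2) *
        (-Real.negMulLog (p i) + p i * Real.log Z - p i) =
      -entropy ρ + Real.log Z - 1 := by
    simp only [hr, one_mul, Finset.sum_sub_distrib, Finset.sum_add_distrib, ← Finset.sum_mul,
      hp1, Finset.sum_neg_distrib, hS]
  rw [e1, e2, ← hE]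
  simp only [hc, one_mul, hq1]
  rw [mul_sub, mul_sub, hF]
  field_simp
  ring

/-- The Gibbs variational principle. -/
theorem freeEnergy_le [Nontrivial (NParticle s Nb N)] {β : ℝ} (hβ : 0 < β)
    {H ρ : Operator s Nb N} (hH : IsSelfAdjoint H) (hρ : ρ ∈ densityOperators s Nb N) :
    freeEnergy β H ≤ (Tr (ρ * H)).re - β⁻¹ * entropy ρ := by
  obtain ⟨e, p, he⟩ := exists_eigenbasis hρ.1.isSelfAdjoint
  obtain ⟨f, h, hf⟩ := exists_eigenbasis hH
  have key := helmholtz_sub_freeEnergy hβ hH hρ.1.isSelfAdjoint hρ.2 he hf (fun _ => rfl)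
  have : Nonempty (Fin (Module.finrank ℂ (NParticle s Nb N))) :=
    ⟨⟨0, Module.finrank_pos⟩⟩
  have hp : ∀ i, 0 ≤ p i := by
    intro i
    have := hρ.1.inner_nonneg_right (e i)
    rw [he, inner_smul_right] at this
    simpa using this
  have h0 : 0 ≤ β * ((Tr (ρ * H)).re - β⁻¹ * entropy ρ - freeEnergy β H) := by
    rw [key]
    refine Finset.sum_nonneg fun i _ => Finset.sum_nonneg fun j _ => ?_
    exact mul_nonneg (by positivity)
      (relEntropy_term_nonneg (hp i) (div_pos (Real.exp_pos _) (sum_exp_pos _)))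
  have := nonneg_of_mul_nonneg_right h0 hβ
  linarith

/-- The relative entropy vanishes, hence so does each of its nonnegative summands: p i = q j
whenever e i and f j overlap. Expanding f j in the eigenbasis of ρ then shows that ρ acts on it as q
j. -/
theorem eq_thermalState_of_le [Nontrivial (NParticle s Nb N)] {β : ℝ} (hβ : 0 < β)
    {H ρ : Operator s Nb N} (hH : IsSelfAdjoint H) (hρ : ρ ∈ densityOperators s Nb N)
    (hle : (Tr (ρ * H)).re - β⁻¹ * entropy ρ ≤ freeEnergy β H) : ρ = thermalState β H := by
  obtain ⟨e, p, he⟩ := exists_eigenbasis hρ.1.isSelfAdjoint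
  obtain ⟨f, h, hf⟩ := exists_eigenbasis hH
  have key := helmholtz_sub_freeEnergy hβ hH hρ.1.isSelfAdjoint hρ.2 he hf (fun _ => rfl)
  have : Nonempty (Fin (Module.finrank ℂ (NParticle s Nb N))) :=
    ⟨⟨0, Module.finrank_pos⟩⟩
  have hp : ∀ i, 0 ≤ p i := by
    intro i
    have := hρ.1.inner_nonneg_right (e i)
    rw [he, inner_smul_right] at this
    simpa using this
  have hq : ∀ j, 0 < Real.exp (-β * h j) / ∑ k, Real.exp (-β * h k) := fun j =>
    div_pos (Real.exp_pos _) (sum_exp_pos _)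
  rw [le_antisymm hle (freeEnergy_le hβ hH hρ), sub_self, mul_zero] at key
  have hn := fun i j => mul_nonneg (sq_nonneg ‖inner ℂ (e i) (f j)‖)
    (relEntropy_term_nonneg (hp i) (hq j))
  have h1 := (Finset.sum_eq_zero_iff_of_nonneg
    (fun i _ => Finset.sum_nonneg fun j _ => hn i j)).1 key.symm
  have h2 : ∀ i j, inner ℂ (e i) (f j) ≠ 0 →
      p i = Real.exp (-β * h j) / ∑ k, Real.exp (-β * h k) := by
    intro i j hij
    have h3 := (Finset.sum_eq_zero_iff_of_nonneg (fun j _ => hn i j)).1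
      (h1 i (Finset.mem_univ _)) j (Finset.mem_univ _)
    exact relEntropy_term_eq_zero (hp i) (hq j)
      ((mul_eq_zero.1 h3).resolve_left (by simpa using hij))
  have h4 : (ρ : NParticle s Nb N →ₗ[ℂ] NParticle s Nb N) = thermalState β H := by
    refine f.toBasis.ext fun j => ?_
    rw [OrthonormalBasis.coe_toBasis]
    change ρ (f j) = thermalState β H (f j)
    rw [thermalState_apply hH f hf]
    conv_lhs => rw [← e.sum_repr (f j), map_sum]
    conv_rhs => rw [← e.sum_repr (f j), Finset.smul_sum]
    refine Finset.sum_congr rfl fun i _ => ?_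
    rw [map_smul, he, e.repr_apply_apply, smul_smul, smul_smul, mul_comm]
    by_cases hij : inner ℂ (e i) (f j) = 0
    · simp [hij]
    · rw [h2 i j hij]
  ext x
  exact congrArg (fun L : NParticle s Nb N →ₗ[ℂ] NParticle s Nb N => L x) h4

/-- Take both eigenbases equal: off-diagonal overlaps vanish, and the diagonal summands vanish
because p = q. -/
theorem helmholtz_thermalState [Nontrivial (NParticle s Nb N)] {β : ℝ} (hβ : 0 < β)
    {H : Operator s Nb N} (hH : IsSelfAdjoint H) :
    (Tr (thermalState β H * H)).re - β⁻¹ * entropy (thermalState β H) = freeEnergy β H := by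
  obtain ⟨f, h, hf⟩ := exists_eigenbasis hH
  have hρ := thermalState_mem β hH
  have key := helmholtz_sub_freeEnergy hβ hH hρ.1.isSelfAdjoint hρ.2
    (thermalState_apply hH f hf) hf (fun _ => rfl)
  have h0 : β * ((Tr (thermalState β H * H)).re - β⁻¹ * entropy (thermalState β H) -
      freeEnergy β H) = 0 := by
    rw [key]
    refine Finset.sum_eq_zero fun i _ => Finset.sum_eq_zero fun j _ => ?_
    by_cases hij : i = j
    · subst hij
      simp only [Real.negMulLog]
      ring
    · rw [f.orthonormal.2 hij]
      simp
  have := (mul_eq_zero.1 h0).resolve_left hβ.ne'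
  linarith

/-- The partition function is at least its ground-state term, so the free energy is at most the
lowest eigenvalue. -/
theorem freeEnergy_le_inner [Nontrivial (NParticle s Nb N)] {β : ℝ} (hβ : 0 < β)
    {H : Operator s Nb N} (hH : IsSelfAdjoint H) {x : NParticle s Nb N} (hx : ‖x‖ = 1) :
    freeEnergy β H ≤ (inner ℂ x (H x)).re := by
  obtain ⟨f, h, hf⟩ := exists_eigenbasis hH
  have : Nonempty (Fin (Module.finrank ℂ (NParticle s Nb N))) :=
    ⟨⟨0, Module.finrank_pos⟩⟩
  obtain ⟨j, hj⟩ := Finite.exists_min h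
  have h1 : h j ≤ (inner ℂ x (H x)).re := by
    rw [re_inner_apply_eq_sum f hf, Complex.ofReal_re]
    calc h j = h j * ‖x‖ ^ 2 := by simp [hx]
      _ = ∑ i, h j * ‖inner ℂ (f i) x‖ ^ 2 := by
        rw [← f.sum_sq_norm_inner_right, Finset.mul_sum]
      _ ≤ _ := Finset.sum_le_sum fun i _ => mul_le_mul_of_nonneg_right (hj i) (by positivity)
  refine le_trans ?_ h1
  rw [freeEnergy, Tr_exp_eq hH f hf, Complex.ofReal_re]
  have h2 : Real.exp (-β * h j) ≤ ∑ k, Real.exp (-β * h k) :=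
    Finset.single_le_sum (f := fun k => Real.exp (-β * h k))
      (fun _ _ => (Real.exp_pos _).le) (Finset.mem_univ j)
  have h3 := Real.log_le_log (Real.exp_pos _) h2
  rw [Real.log_exp] at h3
  rw [neg_mul, neg_le, ← sub_nonneg]
  have : β⁻¹ * Real.log (∑ k, Real.exp (-β * h k)) - -h j =
    β⁻¹ * (Real.log (∑ k, Real.exp (-β * h k)) - -β * h j) := by field_simp
  rw [this]
  exact mul_nonneg (inv_nonneg.2 hβ.le) (sub_nonneg.2 h3)

/-! ### One-body operators on coefficient functions, and products of orbitals. -/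

theorem Statistics.phase_mul (σ τ : Equiv.Perm (Fin N)) :
    s.phase (σ * τ) = s.phase σ * s.phase τ := by
  cases s <;> simp [Statistics.phase]

theorem Statistics.phase_mul_self (σ : Equiv.Perm (Fin N)) : s.phase σ * s.phase σ = 1 := by
  cases s
  · simp [Statistics.phase]
  · simp only [Statistics.phase]
    rw [← Units.val_mul, Int.units_mul_self, Units.val_one]

/-- The coefficients of an `N`-particle state in the product basis. -/
def NParticle.coeff (ψ : NParticle s Nb N) (x : Fin N → Fin Nb) : ℂ := ψ.1 x

namespace NParticle

theorem ext_coeff {ψ φ : NParticle s Nb N} (h : ∀ x, ψ.coeff x = φ.coeff x) : ψ = φ :=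
  Subtype.ext (PiLp.ext h)

theorem coeff_comp (ψ : NParticle s Nb N) (σ : Equiv.Perm (Fin N)) (x : Fin N → Fin Nb) :
    ψ.coeff (x ∘ σ) = (s.phase σ : ℂ) * ψ.coeff x := ψ.2 σ x

theorem coeff_zero (x : Fin N → Fin Nb) : (0 : NParticle s Nb N).coeff x = 0 := rfl

theorem coeff_smul (c : ℂ) (ψ : NParticle s Nb N) (x : Fin N → Fin Nb) :
    (c • ψ).coeff x = c * ψ.coeff x := rfl

theorem inner_eq_sum (φ ψ : NParticle s Nb N) :
    inner ℂ φ ψ = ∑ x, (starRingEnd ℂ) (φ.coeff x) * ψ.coeff x := by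
  change inner ℂ φ.1 ψ.1 = _
  rw [PiLp.inner_apply]
  refine Finset.sum_congr rfl fun x _ => ?_
  rw [RCLike.inner_apply, mul_comm]
  rfl

/-- The state with given coefficients of the right symmetry. -/
def mk (c : (Fin N → Fin Nb) → ℂ)
    (hc : ∀ (σ : Equiv.Perm (Fin N)) (x : Fin N → Fin Nb), c (x ∘ σ) = (s.phase σ : ℂ) * c x) :
    NParticle s Nb N :=
  ⟨WithLp.toLp 2 c, hc⟩

theorem coeff_mk (c : (Fin N → Fin Nb) → ℂ)
    (hc : ∀ (σ : Equiv.Perm (Fin N)) (x : Fin N → Fin Nb), c (x ∘ σ) = (s.phase σ : ℂ) * c x)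
    (x : Fin N → Fin Nb) : (mk c hc : NParticle s Nb N).coeff x = c x := rfl

theorem coeff_annihilation {n : ℕ} (i : Fin Nb) (ψ : NParticle s Nb (n + 1))
    (x : Fin n → Fin Nb) : (annihilation s Nb n i ψ).coeff x =
      (Real.sqrt (n + 1) : ℂ) * ψ.coeff (Fin.cons i x : Fin (n + 1) → Fin Nb) := rfl

end NParticle

/-- The action of `v` on the `k`-th tensor factor, on coefficients. -/
def factorAction (v : OneBody Nb) (c : (Fin N → Fin Nb) → ℂ) (k : Fin N) (x : Fin N → Fin Nb) :
    ℂ :=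
  ∑ y, v (x k) y * c (Function.update x k y)

theorem factorAction_comp (v : OneBody Nb) (ψ : NParticle s Nb N) (k : Fin N)
    (σ : Equiv.Perm (Fin N)) (x : Fin N → Fin Nb) :
    factorAction v ψ.coeff k (x ∘ σ) = (s.phase σ : ℂ) * factorAction v ψ.coeff (σ k) x := by
  simp only [factorAction, Finset.mul_sum]
  refine Finset.sum_congr rfl fun y _ => ?_
  have : Function.update (x ∘ σ) k y = Function.update x (σ k) y ∘ σ := by
    rw [Function.update_comp_equiv, Equiv.symm_apply_apply]
  rw [this, NParticle.coeff_comp]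
  simp only [Function.comp_apply]
  ring

/-- The sum over all particles of the action of `v` on one particle. -/
def secondQuantized (v : OneBody Nb) (ψ : NParticle s Nb N) : NParticle s Nb N :=
  NParticle.mk (fun x => ∑ k, factorAction v ψ.coeff k x) (by
    intro σ x
    simp only [factorAction_comp]
    rw [← Finset.mul_sum, Equiv.sum_comp σ fun k => factorAction v ψ.coeff k x])

theorem hopping_inner {n : ℕ} (i j : Fin Nb) (φ ψ : NParticle s Nb (n + 1)) :
    inner ℂ φ (hopping s Nb (n + 1) i j ψ) =
      inner ℂ (annihilation s Nb n i φ) (annihilation s Nb n j ψ) := by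
  rw [hopping, ContinuousLinearMap.comp_apply, ContinuousLinearMap.adjoint_inner_right]

theorem potential_apply (v : OneBody Nb) (ψ : NParticle s Nb N) :
    potential s N v ψ = ∑ i, ∑ j, v i j • hopping s Nb N i j ψ := by
  simp [potential]

/-- By symmetry all N tensor factors contribute equally to a matrix element, so the sum is N times
the contribution of factor 0. Annihilation strips off that factor with weight √N on each side. -/
theorem potential_apply_eq (v : OneBody Nb) (ψ : NParticle s Nb N) :
    potential s N v ψ = secondQuantized v ψ := by
  cases N with
  | zero =>
    refine NParticle.ext_coeff fun x => ?_
    simp [potential_apply, hopping, secondQuantized, NParticle.coeff_mk, NParticle.coeff_zero]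
  | succ n =>
    refine ext_inner_left ℂ fun φ => ?_
    have hR : inner ℂ φ (secondQuantized v ψ) =
        ∑ k, ∑ x, (starRingEnd ℂ) (φ.coeff x) * factorAction v ψ.coeff k x := by
      rw [NParticle.inner_eq_sum, Finset.sum_comm]
      simp only [secondQuantized, NParticle.coeff_mk, Finset.mul_sum]
    have hk : ∀ k, ∑ x, (starRingEnd ℂ) (φ.coeff x) * factorAction v ψ.coeff k x =
        ∑ x, (starRingEnd ℂ) (φ.coeff x) * factorAction v ψ.coeff 0 x := by
      intro k
      -- Exchanging factors 0 and k multiplies both entries of the inner product by the phase of τ,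
      -- which squares to one.
      set τ := Equiv.swap 0 k
      rw [← Equiv.sum_comp (Equiv.arrowCongr τ (Equiv.refl (Fin Nb)))]
      refine Finset.sum_congr rfl fun x _ => ?_
      have hx : (Equiv.arrowCongr τ (Equiv.refl (Fin Nb))) x = x ∘ τ := by
        funext i
        simp [Equiv.arrowCongr, τ]
      have hp : (s.phase τ : ℂ) * (s.phase τ : ℂ) = 1 := by
        exact_mod_cast Statistics.phase_mul_self τ
      rw [hx, NParticle.coeff_comp, factorAction_comp, map_mul, map_intCast]
      have : τ k = 0 := Equiv.swap_apply_right _ _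
      rw [this, mul_mul_mul_comm, hp, one_mul]
    have h0 : ∑ x, (starRingEnd ℂ) (φ.coeff x) * factorAction v ψ.coeff 0 x =
        ∑ i, ∑ x : Fin n → Fin Nb, (starRingEnd ℂ) (φ.coeff (Fin.cons i x : Fin (n + 1) → Fin Nb)) *
          ∑ j, v i j * ψ.coeff (Fin.cons j x : Fin (n + 1) → Fin Nb) := by
      rw [← Equiv.sum_comp (Fin.consEquiv fun _ : Fin (n + 1) => Fin Nb), Fintype.sum_prod_type]
      simp [factorAction, Fin.consEquiv]
    have hL : inner ℂ φ (potential s (n + 1) v ψ) = ∑ i, ∑ j, v i j *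
        ∑ x : Fin n → Fin Nb, ((n : ℂ) + 1) *
          ((starRingEnd ℂ) (φ.coeff (Fin.cons i x : Fin (n + 1) → Fin Nb)) *
            ψ.coeff (Fin.cons j x : Fin (n + 1) → Fin Nb)) := by
      have hsq : (Real.sqrt (n + 1) : ℂ) * (Real.sqrt (n + 1) : ℂ) = (n : ℂ) + 1 := by
        rw [← Complex.ofReal_mul, Real.mul_self_sqrt (by positivity)]
        push_cast; rfl
      rw [potential_apply, inner_sum]
      refine Finset.sum_congr rfl fun i _ => ?_
      rw [inner_sum]
      refine Finset.sum_congr rfl fun j _ => ?_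
      rw [inner_smul_right, hopping_inner, NParticle.inner_eq_sum]
      congr 1
      refine Finset.sum_congr rfl fun x _ => ?_
      rw [NParticle.coeff_annihilation, NParticle.coeff_annihilation, map_mul, Complex.conj_ofReal,
        mul_mul_mul_comm, hsq]
    rw [hL, hR, Finset.sum_congr rfl fun k _ => hk k, Finset.sum_const, h0, Finset.card_univ,
      Fintype.card_fin, nsmul_eq_mul]
    simp only [Finset.mul_sum]
    refine Finset.sum_congr rfl fun i _ => ?_
    rw [Finset.sum_comm]
    refine Finset.sum_congr rfl fun j _ => Finset.sum_congr rfl fun x _ => ?_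
    push_cast
    ring

theorem coeff_potential (v : OneBody Nb) (ψ : NParticle s Nb N) (x : Fin N → Fin Nb) :
    (potential s N v ψ).coeff x = ∑ k, ∑ y, v (x k) y * ψ.coeff (Function.update x k y) := by
  rw [potential_apply_eq]
  rfl

theorem potential_one : potential s N (1 : OneBody Nb) = (N : ℂ) • 1 := by
  ext ψ
  refine NParticle.ext_coeff fun x => ?_
  rw [coeff_potential]
  simp [Matrix.one_apply, NParticle.coeff_smul]

theorem potential_sub (v w : OneBody Nb) :
    potential s N (v - w) = potential s N v - potential s N w := by
  simp [potential, sub_smul, Finset.sum_sub_distrib]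

theorem adjoint_hopping (i j : Fin Nb) :
    ContinuousLinearMap.adjoint (hopping s Nb N i j) = hopping s Nb N j i := by
  cases N with
  | zero => simp [hopping]
  | succ n => simp [hopping, ContinuousLinearMap.adjoint_comp]

theorem isSelfAdjoint_potential {v : OneBody Nb} (hv : v.IsHermitian) :
    IsSelfAdjoint (potential s N v) := by
  rw [isSelfAdjoint_iff]
  simp only [potential, star_sum]
  rw [Finset.sum_comm]
  refine Finset.sum_congr rfl fun i _ => Finset.sum_congr rfl fun j _ => ?_
  rw [star_smul, ContinuousLinearMap.star_eq_adjoint, adjoint_hopping, hv.apply]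

/-- The expectation value of a potential in terms of the 1RDM. -/
theorem Tr_mul_potential (ρ : Operator s Nb N) (v : OneBody Nb) :
    Tr (ρ * potential s N v) = (v * rdm ρ).trace := by
  simp only [potential, Finset.mul_sum, Tr_sum, mul_smul_comm, Tr_smul, Matrix.trace,
    Matrix.diag_apply, Matrix.mul_apply, rdm, Matrix.of_apply]

theorem trace_rdm {ρ : Operator s Nb N} (hρ : Tr ρ = 1) : (rdm ρ).trace = N := by
  have h := Tr_mul_potential ρ 1
  rw [Matrix.one_mul, potential_one, mul_smul_comm, mul_one, Tr_smul, hρ, mul_one] at h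
  exact h.symm

/-- The (anti)symmetrized product of the orbitals `u (f k)`. -/
def symmetrizedProduct (s : Statistics) (u : Fin Nb → Fin Nb → ℂ) (f : Fin N → Fin Nb) :
    NParticle s Nb N :=
  NParticle.mk (fun x => ∑ σ : Equiv.Perm (Fin N), (s.phase σ : ℂ) * ∏ k, u (f (σ k)) (x k)) (by
    intro τ x
    rw [← Equiv.sum_comp (Equiv.mulRight τ), Finset.mul_sum]
    refine Finset.sum_congr rfl fun σ _ => ?_
    rw [Equiv.coe_mulRight, Statistics.phase_mul,
      ← Equiv.prod_comp τ fun k => u (f (σ k)) (x k)]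
    simp only [Equiv.Perm.coe_mul, Function.comp_apply]
    push_cast
    ring)

/-- Each permuted product of eigenorbitals is an eigenvector, and the eigenvalue, a sum over all
factors, does not depend on the permutation. -/
theorem potential_symmetrizedProduct {v : OneBody Nb} {u : Fin Nb → Fin Nb → ℂ} {l : Fin Nb → ℝ}
    (hu : ∀ i x, ∑ y, v x y * u i y = l i * u i x) (f : Fin N → Fin Nb) :
    potential s N v (symmetrizedProduct s u f) =
      ((∑ k, l (f k) : ℝ) : ℂ) • symmetrizedProduct s u f := by
  refine NParticle.ext_coeff fun x => ?_
  rw [coeff_potential, NParticle.coeff_smul]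
  simp only [symmetrizedProduct, NParticle.coeff_mk]
  have h1 : ∀ (σ : Equiv.Perm (Fin N)) (k : Fin N), ∑ y, v (x k) y *
      ∏ m, u (f (σ m)) (Function.update x k y m) = l (f (σ k)) * ∏ m, u (f (σ m)) (x m) := by
    intro σ k
    rw [← Finset.mul_prod_erase _ _ (Finset.mem_univ k), ← mul_assoc, ← hu, Finset.sum_mul]
    refine Finset.sum_congr rfl fun y _ => ?_
    rw [← Finset.mul_prod_erase _ _ (Finset.mem_univ k), Function.update_self, ← mul_assoc]
    congr 1
    refine Finset.prod_congr rfl fun m hm => ?_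
    rw [Function.update_of_ne (Finset.ne_of_mem_erase hm)]
  calc _ = ∑ k, ∑ σ : Equiv.Perm (Fin N), (s.phase σ : ℂ) * ∑ y, v (x k) y *
        ∏ m, u (f (σ m)) (Function.update x k y m) := by
        refine Finset.sum_congr rfl fun k _ => ?_
        simp only [Finset.mul_sum]
        rw [Finset.sum_comm]
        refine Finset.sum_congr rfl fun σ _ => Finset.sum_congr rfl fun y _ => ?_
        ring
    _ = _ := by
        simp only [h1]
        rw [Finset.sum_comm, Finset.mul_sum]
        refine Finset.sum_congr rfl fun σ _ => ?_
        rw [← Equiv.sum_comp σ fun k => l (f k)]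
        push_cast
        rw [Finset.sum_mul]
        refine Finset.sum_congr rfl fun k _ => ?_
        ring

/-- Pair with the unsymmetrized product. By orthonormality the overlap is the sum of the phases of
the σ with f ∘ σ = f: for bosons their positive number, for fermions 1, as injectivity of f leaves
only the identity. -/
theorem symmetrizedProduct_ne_zero {u : Fin Nb → Fin Nb → ℂ}
    (hu : ∀ i j, ∑ y, (starRingEnd ℂ) (u i y) * u j y = if i = j then 1 else 0)
    {f : Fin N → Fin Nb} (hf : s = Statistics.fermion → Function.Injective f) :
    symmetrizedProduct s u f ≠ 0 := by
  intro h0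
  have hz : ∑ x : Fin N → Fin Nb, (∏ k, (starRingEnd ℂ) (u (f k) (x k))) *
      (symmetrizedProduct s u f).coeff x = 0 := by
    rw [h0]
    simp [NParticle.coeff_zero]
  have hs : ∑ σ : Equiv.Perm (Fin N), (s.phase σ : ℂ) *
      (∏ k, if f k = f (σ k) then (1 : ℂ) else 0) = 0 := by
    refine Eq.trans ?_ hz
    simp only [symmetrizedProduct, NParticle.coeff_mk, Finset.mul_sum]
    rw [Finset.sum_comm]
    refine Finset.sum_congr rfl fun σ _ => ?_
    rw [Finset.prod_congr rfl fun k _ => (hu (f k) (f (σ k))).symm, Finset.prod_univ_sum,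
      Fintype.piFinset_univ, Finset.mul_sum]
    refine Finset.sum_congr rfl fun x _ => ?_
    rw [Finset.prod_mul_distrib]
    ring
  cases s with
  | boson =>
    simp only [Statistics.phase, Finset.prod_ite_zero, Finset.prod_const_one, Int.cast_one, one_mul,
      Finset.sum_boole, Nat.cast_eq_zero, Finset.card_eq_zero] at hs
    have : (1 : Equiv.Perm (Fin N)) ∈ (∅ : Finset (Equiv.Perm (Fin N))) := by
      rw [← hs]
      simp
    simp at this
  | fermion =>
    rw [Finset.sum_eq_single 1] at hs
    · simp [Statistics.phase] at hs
    · intro σ _ hσ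
      have : ∃ k, σ k ≠ k := by
        by_contra! hc
        exact hσ (Equiv.ext hc)
      obtain ⟨k, hk⟩ := this
      rw [Finset.prod_eq_zero (Finset.mem_univ k), mul_zero]
      rw [if_neg]
      exact fun h => hk (hf rfl h).symm
    · simp

/-! ### Eigenorbitals, and potentials that act as constants. -/

theorem exists_orthonormal_eigenvectors {v : OneBody Nb} (hv : v.IsHermitian) :
    ∃ (u : Fin Nb → Fin Nb → ℂ) (l : Fin Nb → ℝ),
      (∀ i j, ∑ y, (starRingEnd ℂ) (u i y) * u j y = if i = j then 1 else 0) ∧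
      (∀ x y, ∑ i, u i x * (starRingEnd ℂ) (u i y) = if x = y then 1 else 0) ∧
      (∀ i x, ∑ y, v x y * u i y = l i * u i x) ∧
      (∀ x y, v x y = ∑ i, l i * u i x * (starRingEnd ℂ) (u i y)) := by
  set U := (hv.eigenvectorUnitary : Matrix (Fin Nb) (Fin Nb) ℂ)
  have h1 : star U * U = 1 := Unitary.coe_star_mul_self hv.eigenvectorUnitary
  have h2 : U * star U = 1 := Unitary.coe_mul_star_self hv.eigenvectorUnitary
  have h3 : v = U * Matrix.diagonal (fun i => (hv.eigenvalues i : ℂ)) * star U := by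
    conv_lhs => rw [hv.spectral_theorem]
    rfl
  have h4 : v * U = U * Matrix.diagonal (fun i => (hv.eigenvalues i : ℂ)) := by
    conv_lhs => rw [h3, Matrix.mul_assoc, h1, Matrix.mul_one]
  refine ⟨fun i x => U x i, hv.eigenvalues, fun i j => ?_, fun x y => ?_, fun i x => ?_,
    fun x y => ?_⟩
  · simpa [Matrix.mul_apply, Matrix.star_apply, Matrix.one_apply] using congrFun (congrFun h1 i) j
  · simpa [Matrix.mul_apply, Matrix.star_apply, Matrix.one_apply] using congrFun (congrFun h2 x) y
  · have := congrFun (congrFun h4 x) i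
    rw [Matrix.mul_diagonal] at this
    rw [mul_comm, ← this, Matrix.mul_apply]
  · have := congrFun (congrFun h3 x) y
    rw [this, Matrix.mul_apply]
    refine Finset.sum_congr rfl fun i _ => ?_
    rw [Matrix.mul_diagonal, Matrix.star_apply]
    simp only [RCLike.star_def]
    ring

/-- Serves to arrange the orbitals so that one of two given ones is occupied and the other is empty.
-/
theorem exists_perm_apply_eq {α : Type*} [DecidableEq α] {p q a b : α} (hpq : p ≠ q) (hab : a ≠ b) :
    ∃ π : Equiv.Perm α, π p = a ∧ π q = b := by
  refine ⟨Equiv.swap p a * Equiv.swap q (Equiv.swap p a b), ?_, ?_⟩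
  · rw [Equiv.Perm.mul_apply, Equiv.swap_apply_of_ne_of_ne hpq, Equiv.swap_apply_left]
    intro h
    have := congrArg (Equiv.swap p a) h
    rw [Equiv.swap_apply_left, Equiv.swap_apply_self] at this
    exact hab this
  · rw [Equiv.Perm.mul_apply, Equiv.swap_apply_left, Equiv.swap_apply_self]

theorem nontrivial_nParticle (hNb : 1 ≤ Nb) (hs : s = Statistics.fermion → N < Nb) :
    Nontrivial (NParticle s Nb N) := by
  obtain ⟨u, l, h1, -, -, -⟩ := exists_orthonormal_eigenvectors
    (Matrix.isHermitian_zero (n := Fin Nb) (α := ℂ))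
  have : ∃ f : Fin N → Fin Nb, s = Statistics.fermion → Function.Injective f := by
    cases s with
    | boson => exact ⟨fun _ => ⟨0, hNb⟩, by simp⟩
    | fermion => exact ⟨Fin.castLE (hs rfl).le, fun _ => Fin.castLE_injective _⟩
  obtain ⟨f, hf⟩ := this
  exact ⟨⟨_, 0, symmetrizedProduct_ne_zero h1 hf⟩⟩

/-- A potential that acts on the `N`-particle space as a constant is a constant. -/
theorem eq_smul_one_of_potential_eq_smul_one (hNb : 1 ≤ Nb) (hN : 1 ≤ N)
    (hs : s = Statistics.fermion → N < Nb) {w : OneBody Nb} (hw : w.IsHermitian) {c : ℂ}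
    (hc : potential s N w = c • 1) : ∃ a : ℂ, w = a • 1 ∧ N * a = c := by
  obtain ⟨u, l, h1, h2, h3, h4⟩ := exists_orthonormal_eigenvectors hw
  have key : ∀ f : Fin N → Fin Nb, (s = Statistics.fermion → Function.Injective f) →
      ((∑ k, l (f k) : ℝ) : ℂ) = c := by
    intro f hf
    have h := potential_symmetrizedProduct (s := s) h3 f
    rw [hc] at h
    exact (smul_left_injective ℂ (symmetrizedProduct_ne_zero h1 hf) h).symm
  have hl : ∀ a b, l a = l b := by
    intro a b
    cases s with
    | boson =>
      have := (key (fun _ => a) (by simp)).trans (key (fun _ => b) (by simp)).symm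
      have := Complex.ofReal_injective this
      simp only [Finset.sum_const, Finset.card_univ, Fintype.card_fin, nsmul_eq_mul] at this
      exact mul_left_cancel₀ (by exact_mod_cast (by omega : N ≠ 0)) this
    | fermion =>
      by_cases hab : a = b
      · rw [hab]
      have hlt := hs rfl
      -- The first N positions are filled. Orbital a is put at position 0, b at the empty position
      -- N, which exists because N < Nb.
      obtain ⟨π, hπ0, hπN⟩ := exists_perm_apply_eq
        (p := (⟨0, hNb⟩ : Fin Nb)) (q := ⟨N, hlt⟩) (by simp; omega) hab
      set f : Fin N → Fin Nb := fun k => π (Fin.castLE hlt.le k)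
      have hf : Function.Injective f := π.injective.comp (Fin.castLE_injective _)
      -- Swapping a and b moves a single particle from a to b. Both fillings have energy c, so the
      -- two levels agree.
      have hg : Function.Injective (fun k => Equiv.swap a b (f k)) :=
        (Equiv.swap a b).injective.comp hf
      have := (key f fun _ => hf).trans (key _ fun _ => hg).symm
      have := Complex.ofReal_injective this
      set k₀ : Fin N := ⟨0, hN⟩
      have hf0 : f k₀ = a := hπ0
      rw [← Finset.add_sum_erase _ _ (Finset.mem_univ k₀),
        ← Finset.add_sum_erase _ (fun k => l (Equiv.swap a b (f k))) (Finset.mem_univ k₀), hf0,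
        Equiv.swap_apply_left] at this
      have he : ∑ k ∈ Finset.univ.erase k₀, l (f k) =
          ∑ k ∈ Finset.univ.erase k₀, l (Equiv.swap a b (f k)) := by
        refine Finset.sum_congr rfl fun k hk => ?_
        rw [Equiv.swap_apply_of_ne_of_ne]
        · exact fun h => Finset.ne_of_mem_erase hk (hf (h.trans hf0.symm))
        · intro h
          have h' := π.injective (h.trans hπN.symm)
          have := congrArg Fin.val h'
          simp at this
          omega
      linarith
  have hex : ∃ f : Fin N → Fin Nb, s = Statistics.fermion → Function.Injective f := by
    cases s with
    | boson => exact ⟨fun _ => ⟨0, hNb⟩, by simp⟩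
    | fermion => exact ⟨Fin.castLE (hs rfl).le, fun _ => Fin.castLE_injective _⟩
  obtain ⟨f, hf⟩ := hex
  refine ⟨l ⟨0, hNb⟩, ?_, ?_⟩
  · ext x y
    rw [h4]
    simp only [fun i => hl i ⟨0, hNb⟩, mul_assoc]
    rw [← Finset.mul_sum, h2]
    simp [Matrix.one_apply]
  · rw [← key f hf]
    simp [fun i => hl i ⟨0, hNb⟩]

/-! ### Strictly positive states have purely fractional occupations. -/

theorem conj_Tr (A : Operator s Nb N) :
    (starRingEnd ℂ) (Tr A) = Tr (ContinuousLinearMap.adjoint A) := by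
  have b := stdOrthonormalBasis ℂ (NParticle s Nb N)
  rw [Tr_eq_sum_inner b, Tr_eq_sum_inner b, map_sum]
  refine Finset.sum_congr rfl fun i _ => ?_
  rw [inner_conj_symm, ContinuousLinearMap.adjoint_inner_right]

theorem isHermitian_rdm {ρ : Operator s Nb N} (hρ : IsSelfAdjoint ρ) : (rdm ρ).IsHermitian := by
  refine Matrix.IsHermitian.ext fun i j => ?_
  simp only [rdm, Matrix.of_apply]
  change (starRingEnd ℂ) _ = _
  rw [conj_Tr, ← ContinuousLinearMap.star_eq_adjoint, star_mul, hρ.star_eq,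
    ContinuousLinearMap.star_eq_adjoint, adjoint_hopping, Tr_mul_comm]

/-- In an eigenbasis of A the trace is a sum of eigenvalues, nonnegative and not all zero, weighted
by positive expectations of ρ. -/
theorem re_Tr_mul_pos {ρ A : Operator s Nb N} {c : ℝ} (hc : 0 < c)
    (hρ : ∀ x : NParticle s Nb N, c * ‖x‖ ^ 2 ≤ (inner ℂ x (ρ x)).re) (hA : IsSelfAdjoint A)
    (hA' : ∀ x : NParticle s Nb N, 0 ≤ (inner ℂ x (A x)).re) (h0 : A ≠ 0) :
    0 < (Tr (ρ * A)).re := by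
  obtain ⟨b, a, hb⟩ := exists_eigenbasis hA
  have ha : ∀ i, 0 ≤ a i := by
    intro i
    have := hA' (b i)
    rw [hb, inner_smul_right] at this
    simpa using this
  have hp : ∀ i, 0 < (inner ℂ (b i) (ρ (b i))).re := by
    intro i
    have := hρ (b i)
    simp only [b.norm_eq_one, one_pow, mul_one] at this
    exact hc.trans_le this
  have hT : (Tr (ρ * A)).re = ∑ i, a i * (inner ℂ (b i) (ρ (b i))).re := by
    rw [Tr_eq_sum_inner b, Complex.re_sum]
    refine Finset.sum_congr rfl fun i _ => ?_
    rw [mul_apply_eq_comp, hb, map_smul, inner_smul_right, Complex.re_ofReal_mul]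
  have hex : ∃ i, a i ≠ 0 := by
    by_contra! h
    refine h0 ?_
    have h4 : (A : NParticle s Nb N →ₗ[ℂ] NParticle s Nb N) = 0 := by
      refine b.toBasis.ext fun j => ?_
      rw [OrthonormalBasis.coe_toBasis]
      change A (b j) = 0
      rw [hb, h]
      simp
    ext x
    exact congrArg (fun L : NParticle s Nb N →ₗ[ℂ] NParticle s Nb N => L x) h4
  obtain ⟨i, hi⟩ := hex
  rw [hT]
  exact Finset.sum_pos' (fun j _ => mul_nonneg (ha j) (hp j).le)
    ⟨i, Finset.mem_univ _, mul_pos ((ha i).lt_of_ne hi.symm) (hp i)⟩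

/-- The occupation `z† γ z` of the orbital `z`. -/
def occupation (γ : OneBody Nb) (z : Fin Nb → ℂ) : ℝ := (star z ⬝ᵥ γ.mulVec z).re

/-- The squared Euclidean norm of an orbital. -/
def sqNorm (z : Fin Nb → ℂ) : ℝ := ∑ i, ‖z i‖ ^ 2

theorem sqNorm_nonneg (z : Fin Nb → ℂ) : 0 ≤ sqNorm z :=
  Finset.sum_nonneg fun _ _ => sq_nonneg _

theorem sqNorm_pos {z : Fin Nb → ℂ} (hz : z ≠ 0) : 0 < sqNorm z := by
  obtain ⟨i, hi⟩ := Function.ne_iff.1 hz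
  exact Finset.sum_pos' (fun _ _ => sq_nonneg _)
    ⟨i, Finset.mem_univ _, by have := norm_pos_iff.2 hi; positivity⟩

theorem dotProduct_mulVec_eq_ofReal {γ : OneBody Nb} (hγ : γ.IsHermitian) (z : Fin Nb → ℂ) :
    star z ⬝ᵥ γ.mulVec z = (occupation γ z : ℂ) := by
  rw [occupation, eq_comm, ← Complex.conj_eq_iff_re]
  change star _ = _
  conv_lhs => rw [Matrix.star_dotProduct, star_star, Matrix.star_mulVec, hγ.eq,
    ← Matrix.dotProduct_mulVec]

theorem posDef_of_occupation_pos {γ : OneBody Nb} (hγ : γ.IsHermitian)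
    (h : ∀ z, z ≠ 0 → 0 < occupation γ z) : γ.PosDef := by
  refine Matrix.PosDef.of_dotProduct_mulVec_pos hγ fun z hz => ?_
  rw [dotProduct_mulVec_eq_ofReal hγ]
  exact_mod_cast h z hz

theorem occupation_pos_of_posDef {γ : OneBody Nb} (hγ : γ.PosDef) {z : Fin Nb → ℂ} (hz : z ≠ 0) :
    0 < occupation γ z := (Complex.pos_iff.1 (hγ.dotProduct_mulVec_pos hz)).1

/-- The potential `|z⟩⟨z|`. -/
def orbitalProjector (z : Fin Nb → ℂ) : OneBody Nb := Matrix.vecMulVec z (star z)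

theorem orbitalProjector_apply (z : Fin Nb → ℂ) (i j : Fin Nb) :
    orbitalProjector z i j = z i * (starRingEnd ℂ) (z j) := rfl

theorem isHermitian_orbitalProjector (z : Fin Nb → ℂ) : (orbitalProjector z).IsHermitian :=
  (Matrix.posSemidef_vecMulVec_self_star z).1

theorem sum_mul_conj_eq_sqNorm (z : Fin Nb → ℂ) :
    ∑ i, z i * (starRingEnd ℂ) (z i) = (sqNorm z : ℂ) := by
  simp [sqNorm, Complex.mul_conj']

theorem trace_orbitalProjector (z : Fin Nb → ℂ) : (orbitalProjector z).trace = (sqNorm z : ℂ) :=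
  sum_mul_conj_eq_sqNorm z

theorem Tr_mul_potential_orbitalProjector (ρ : Operator s Nb N) (z : Fin Nb → ℂ) :
    (Tr (ρ * potential s N (orbitalProjector z))).re = occupation (rdm ρ) z := by
  rw [Tr_mul_potential, occupation]
  congr 1
  simp only [Matrix.trace, Matrix.diag_apply, Matrix.mul_apply, dotProduct, Matrix.mulVec,
    orbitalProjector_apply, Finset.mul_sum, Pi.star_apply]
  rw [Finset.sum_comm]
  refine Finset.sum_congr rfl fun i _ => Finset.sum_congr rfl fun j _ => ?_
  change _ = (starRingEnd ℂ) (z i) * _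
  ring

theorem potential_orbitalProjector_ne (hNb : 1 ≤ Nb) (hN : 1 ≤ N)
    (hs : s = Statistics.fermion → N < Nb) {z : Fin Nb → ℂ} (hz : z ≠ 0) :
    potential s N (orbitalProjector z) ≠ 0 := by
  intro h
  obtain ⟨a, ha, hNa⟩ := eq_smul_one_of_potential_eq_smul_one (s := s) hNb hN hs
    (isHermitian_orbitalProjector z) (c := 0) (by rw [h, zero_smul])
  have h0 : a = 0 := (mul_eq_zero.1 hNa).resolve_left (by exact_mod_cast (by omega : N ≠ 0))
  have := trace_orbitalProjector z
  rw [ha, h0, zero_smul, Matrix.trace_zero] at this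
  exact (sqNorm_pos hz).ne (by exact_mod_cast this)

/-- Otherwise |z⟩⟨z| would be a scalar a with N a = |z|², while its trace gives Nb a = |z|²; hence N
= Nb. -/
theorem potential_orbitalProjector_ne_sqNorm (hNb : 1 ≤ Nb) (hN : 1 ≤ N) (hlt : N < Nb)
    {z : Fin Nb → ℂ} (hz : z ≠ 0) :
    potential s N (orbitalProjector z) ≠ (sqNorm z : ℂ) • 1 := by
  intro h
  obtain ⟨a, ha, hNa⟩ := eq_smul_one_of_potential_eq_smul_one (s := s) hNb hN (fun _ => hlt)
    (isHermitian_orbitalProjector z) h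
  have := trace_orbitalProjector z
  rw [ha, Matrix.trace_smul, Matrix.trace_one, Fintype.card_fin, smul_eq_mul, ← hNa,
    mul_comm] at this
  have ha0 : a ≠ 0 := by
    rintro rfl
    rw [mul_zero] at hNa
    exact (sqNorm_pos hz).ne (by exact_mod_cast hNa)
  have := mul_right_cancel₀ ha0 this
  have : Nb = N := by exact_mod_cast this
  omega

/-- The operator is b†b with b = ∑ conj(z i) a i. -/
theorem inner_potential_orbitalProjector_nonneg (hN : 1 ≤ N) (z : Fin Nb → ℂ)
    (ψ : NParticle s Nb N) : 0 ≤ (inner ℂ ψ (potential s N (orbitalProjector z) ψ)).re := by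
  obtain ⟨n, rfl⟩ : ∃ n, N = n + 1 := ⟨N - 1, by omega⟩
  set φ := ∑ i, (starRingEnd ℂ) (z i) • annihilation s Nb n i ψ
  have : inner ℂ ψ (potential s (n + 1) (orbitalProjector z) ψ) = inner ℂ φ φ := by
    rw [potential_apply, inner_sum, sum_inner]
    refine Finset.sum_congr rfl fun i _ => ?_
    rw [inner_sum, inner_sum]
    refine Finset.sum_congr rfl fun j _ => ?_
    rw [inner_smul_right, hopping_inner, inner_smul_left, inner_smul_right, Complex.conj_conj,
      orbitalProjector_apply, mul_assoc]
  rw [this]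
  exact inner_self_nonneg (𝕜 := ℂ)

/-- Pauli principle: exchanging the two factors turns the sum into its negative. -/
theorem fermion_pair_contraction (ψ : NParticle Statistics.fermion Nb N) (g : Fin Nb → ℂ)
    {k l : Fin N} (hkl : k ≠ l) (x : Fin N → Fin Nb) :
    ∑ y, ∑ y', g y * g y' * ψ.coeff (Function.update (Function.update x k y) l y') = 0 := by
  have h : ∀ y y', ψ.coeff (Function.update (Function.update x k y) l y') =
      -ψ.coeff (Function.update (Function.update x k y') l y) := by
    intro y y'
    have e : Function.update (Function.update x k y) l y' =
        Function.update (Function.update x k y') l y ∘ Equiv.swap k l := by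
      funext m
      by_cases hk : m = k
      · subst hk
        simp [hkl]
      by_cases hl : m = l
      · subst hl
        simp [hkl]
      · simp [Equiv.swap_apply_of_ne_of_ne hk hl, hk, hl]
    rw [e, NParticle.coeff_comp]
    simp [Statistics.phase, Equiv.Perm.sign_swap hkl]
  rw [← CharZero.eq_neg_self_iff]
  conv_lhs => rw [Finset.sum_comm]
  rw [← Finset.sum_neg_distrib]
  refine Finset.sum_congr rfl fun y _ => ?_
  rw [← Finset.sum_neg_distrib]
  refine Finset.sum_congr rfl fun y' _ => ?_
  rw [h]
  ring

/-- In n_z², two actions on the same factor give |z|² times one action; two actions on different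
factors vanish by `fermion_pair_contraction`. -/
theorem fermion_potential_orbitalProjector_sq (z : Fin Nb → ℂ)
    (ψ : NParticle Statistics.fermion Nb N) :
    potential _ N (orbitalProjector z) (potential _ N (orbitalProjector z) ψ) =
      (sqNorm z : ℂ) • potential _ N (orbitalProjector z) ψ := by
  refine NParticle.ext_coeff fun x => ?_
  rw [coeff_potential, NParticle.coeff_smul, coeff_potential, Finset.mul_sum]
  refine Finset.sum_congr rfl fun k _ => ?_
  have h1 : ∀ y, (potential _ N (orbitalProjector z) ψ).coeff (Function.update x k y) =
      z y * (∑ y', (starRingEnd ℂ) (z y') * ψ.coeff (Function.update x k y')) +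
      ∑ l ∈ Finset.univ.erase k, z (x l) * ∑ y', (starRingEnd ℂ) (z y') *
        ψ.coeff (Function.update (Function.update x k y) l y') := by
    intro y
    rw [coeff_potential, ← Finset.add_sum_erase _ _ (Finset.mem_univ k)]
    congr 1
    · simp [orbitalProjector_apply, Finset.mul_sum, mul_assoc]
    · refine Finset.sum_congr rfl fun l hl => ?_
      rw [Finset.mul_sum]
      refine Finset.sum_congr rfl fun y' _ => ?_
      rw [Function.update_of_ne (Finset.ne_of_mem_erase hl), orbitalProjector_apply, mul_assoc]
  have h2 : ∑ y, orbitalProjector z (x k) y * ∑ l ∈ Finset.univ.erase k, z (x l) *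
      ∑ y', (starRingEnd ℂ) (z y') *
        ψ.coeff (Function.update (Function.update x k y) l y') = 0 := by
    simp only [Finset.mul_sum]
    rw [Finset.sum_comm]
    refine Finset.sum_eq_zero fun l hl => ?_
    have := fermion_pair_contraction ψ (fun y => (starRingEnd ℂ) (z y))
      (Finset.ne_of_mem_erase hl).symm x
    calc _ = z (x k) * z (x l) * ∑ y, ∑ y', (starRingEnd ℂ) (z y) * (starRingEnd ℂ) (z y') *
          ψ.coeff (Function.update (Function.update x k y) l y') := by
          simp only [Finset.mul_sum, orbitalProjector_apply]
          refine Finset.sum_congr rfl fun y _ => Finset.sum_congr rfl fun y' _ => ?_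
          ring
      _ = 0 := by rw [this, mul_zero]
  simp only [h1, mul_add, Finset.sum_add_distrib]
  rw [h2, add_zero, ← sum_mul_conj_eq_sqNorm, Finset.sum_mul]
  refine Finset.sum_congr rfl fun y _ => ?_
  simp only [orbitalProjector_apply, Finset.mul_sum]
  refine Finset.sum_congr rfl fun y' _ => ?_
  ring

theorem isSelfAdjoint_sub_potential (z : Fin Nb → ℂ) :
    IsSelfAdjoint ((sqNorm z : ℂ) • 1 - potential s N (orbitalProjector z)) := by
  refine IsSelfAdjoint.sub (IsSelfAdjoint.smul ?_ (IsSelfAdjoint.one _))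
    (isSelfAdjoint_potential (isHermitian_orbitalProjector z))
  rw [isSelfAdjoint_iff, Complex.star_def, Complex.conj_ofReal]

/-- A = |z|² - n_z also satisfies A² = |z|² A, so |z|² ⟨ψ, Aψ⟩ = ‖Aψ‖². -/
theorem inner_sub_potential_nonneg {z : Fin Nb → ℂ} (hz : z ≠ 0)
    (ψ : NParticle Statistics.fermion Nb N) :
    0 ≤ (inner ℂ ψ (((sqNorm z : ℂ) • 1 - potential _ N (orbitalProjector z)) ψ)).re := by
  set A := (sqNorm z : ℂ) • (1 : Operator Statistics.fermion Nb N) -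
    potential _ N (orbitalProjector z)
  have hA : IsSelfAdjoint A := isSelfAdjoint_sub_potential z
  have h2 : A (A ψ) = (sqNorm z : ℂ) • A ψ := by
    simp only [A, sub_apply, smul_apply, one_apply_eq_self, map_sub, map_smul,
      fermion_potential_orbitalProjector_sq, smul_sub]
    abel
  have h3 : inner ℂ (A ψ) (A ψ) = inner ℂ ψ (A (A ψ)) := hA.isSymmetric ψ (A ψ)
  rw [h2, inner_smul_right] at h3
  have h4 : 0 ≤ (inner ℂ (A ψ) (A ψ)).re := inner_self_nonneg (𝕜 := ℂ)
  rw [h3, Complex.re_ofReal_mul] at h4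
  exact nonneg_of_mul_nonneg_right h4 (sqNorm_pos hz)

theorem occupation_one (z : Fin Nb → ℂ) : occupation 1 z = sqNorm z := by
  rw [occupation, Matrix.one_mulVec, dotProduct_comm]
  change (∑ i, z i * (starRingEnd ℂ) (z i)).re = _
  rw [sum_mul_conj_eq_sqNorm, Complex.ofReal_re]

theorem occupation_sub (γ γ' : OneBody Nb) (z : Fin Nb → ℂ) :
    occupation (γ - γ') z = occupation γ z - occupation γ' z := by
  simp [occupation, Matrix.sub_mulVec, dotProduct_sub]

theorem occupation_add (γ γ' : OneBody Nb) (z : Fin Nb → ℂ) :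
    occupation (γ + γ') z = occupation γ z + occupation γ' z := by
  simp [occupation, Matrix.add_mulVec, dotProduct_add]

theorem posDef_sub_mul_self {γ : OneBody Nb} (h : γ.PosDef) (h' : (1 - γ).PosDef) :
    (γ - γ * γ).PosDef := by
  -- The two terms on the right are γ(1-γ)γ and γ(1-γ)(1-γ), as γ commutes with 1-γ; in this form
  -- each is visibly a congruence of a positive matrix.
  have e : γ - γ * γ = γ.conjTranspose * (1 - γ) * γ +
      (1 - γ).conjTranspose * γ * (1 - γ) := by
    rw [h.1.eq, h'.1.eq]
    noncomm_ring
  rw [e]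
  exact (h'.conjTranspose_mul_mul_same (Matrix.mulVec_injective_of_isUnit h.isUnit)).add
    (h.conjTranspose_mul_mul_same (Matrix.mulVec_injective_of_isUnit h'.isUnit))

theorem rdm_mem_fractionalRDMs (hNb : 1 ≤ Nb) (hN : 1 ≤ N)
    (hs : s = Statistics.fermion → N < Nb) {ρ : Operator s Nb N} (hρ : IsSelfAdjoint ρ)
    (hT : Tr ρ = 1) {c : ℝ} (hc : 0 < c)
    (hpos : ∀ x : NParticle s Nb N, c * ‖x‖ ^ 2 ≤ (inner ℂ x (ρ x)).re) :
    rdm ρ ∈ fractionalRDMs s Nb N := by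
  have hH := isHermitian_rdm hρ
  have h1 : (rdm ρ).PosDef := by
    refine posDef_of_occupation_pos hH fun z hz => ?_
    rw [← Tr_mul_potential_orbitalProjector]
    exact re_Tr_mul_pos hc hpos (isSelfAdjoint_potential (isHermitian_orbitalProjector z))
      (inner_potential_orbitalProjector_nonneg hN z) (potential_orbitalProjector_ne hNb hN hs hz)
  refine ⟨h1, trace_rdm hT, ?_⟩
  cases s with
  | boson => trivial
  | fermion =>
    refine posDef_sub_mul_self h1 (posDef_of_occupation_pos (Matrix.isHermitian_one.sub hH) ?_)
    intro z hz
    have := re_Tr_mul_pos hc hpos (isSelfAdjoint_sub_potential z) (inner_sub_potential_nonneg hz)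
      (sub_ne_zero.2 (potential_orbitalProjector_ne_sqNorm hNb hN (hs rfl) hz).symm)
    rw [mul_sub, sub_eq_add_neg, ← neg_one_smul ℂ, Tr_add, Tr_smul, mul_smul_comm, mul_one,
      Tr_smul, hT, mul_one, neg_one_mul, Complex.add_re, Complex.neg_re, Complex.ofReal_re,
      Tr_mul_potential_orbitalProjector] at this
    rw [occupation_sub, occupation_one]
    linarith

/-- A quantitative form of the strict bounds on the occupations. -/
def UniformlyFractional (s : Statistics) (N : ℕ) (δ : ℝ) (γ : OneBody Nb) : Prop :=
  γ.IsHermitian ∧ γ.trace = N ∧ ∀ z, δ * sqNorm z ≤ occupation γ z ∧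
    (s = Statistics.fermion → occupation γ z ≤ (1 - δ) * sqNorm z)

/-! ### Uniformly fractional 1RDMs and the energy gap to the lowest filling. -/

theorem occupation_eq_sum {γ : OneBody Nb} {u : Fin Nb → Fin Nb → ℂ} {l : Fin Nb → ℝ}
    (h : ∀ x y, γ x y = ∑ i, l i * u i x * (starRingEnd ℂ) (u i y)) (z : Fin Nb → ℂ) :
    occupation γ z = ∑ i, l i * ‖∑ y, (starRingEnd ℂ) (u i y) * z y‖ ^ 2 := by
  have : star z ⬝ᵥ γ.mulVec z =
      ((∑ i, l i * ‖∑ y, (starRingEnd ℂ) (u i y) * z y‖ ^ 2 : ℝ) : ℂ) := by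
    push_cast
    simp only [← Complex.mul_conj', map_sum, map_mul, Complex.conj_conj, dotProduct, Matrix.mulVec,
      h, Finset.sum_mul, Finset.mul_sum]
    rw [Finset.sum_comm' (t' := Finset.univ) (s' := fun _ => Finset.univ) (by simp)]
    rw [Finset.sum_comm]
    conv_lhs =>
      enter [2, x]
      rw [Finset.sum_comm]
    rw [Finset.sum_comm]
    refine Finset.sum_congr rfl fun i _ => ?_
    refine Finset.sum_congr rfl fun x _ => Finset.sum_congr rfl fun y _ => ?_
    change (starRingEnd ℂ) _ * _ = _
    ring
  rw [occupation, this, Complex.ofReal_re]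

/-- The least eigenvalue serves as δ; for fermions, the lesser of it and the distance of the largest
eigenvalue from 1. -/
theorem exists_uniformlyFractional (hNb : 1 ≤ Nb) {γ : OneBody Nb}
    (hγ : γ ∈ fractionalRDMs s Nb N) : ∃ δ : ℝ, 0 < δ ∧ UniformlyFractional s N δ γ := by
  obtain ⟨hp, ht, hf⟩ := hγ
  obtain ⟨u, l, h1, h2, h3, h4⟩ := exists_orthonormal_eigenvectors hp.1
  have hz : ∀ z, sqNorm z = ∑ i, ‖∑ y, (starRingEnd ℂ) (u i y) * z y‖ ^ 2 := by
    intro z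
    rw [← occupation_one, occupation_eq_sum (u := u) (l := fun _ => 1)]
    · simp
    · intro x y
      simp [h2, Matrix.one_apply]
  have hu0 : ∀ i, u i ≠ 0 := by
    intro i h
    have := h1 i i
    simp [h] at this
  have hu : ∀ i, γ.mulVec (u i) = (l i : ℂ) • u i := by
    intro i
    funext x
    exact h3 i x
  have hn : ∀ i, star (u i) ⬝ᵥ u i = 1 := fun i => (h1 i i).trans (if_pos rfl)
  have hl : ∀ i, 0 < l i := by
    intro i
    have := occupation_pos_of_posDef hp (hu0 i)
    rw [occupation, hu, dotProduct_smul, hn] at this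
    simpa using this
  have hl' : s = Statistics.fermion → ∀ i, l i < 1 := by
    rintro rfl i
    have := occupation_pos_of_posDef hf (hu0 i)
    rw [occupation_sub, occupation, occupation, ← Matrix.mulVec_mulVec, hu, Matrix.mulVec_smul, hu,
      dotProduct_smul, dotProduct_smul, dotProduct_smul, hn] at this
    simp only [smul_eq_mul, mul_one, Complex.ofReal_re, ← Complex.ofReal_mul] at this
    have h5 : 0 < l i * (1 - l i) := by linarith
    have := pos_of_mul_pos_right h5 (hl i).le
    linarith
  have : Nonempty (Fin Nb) := ⟨⟨0, hNb⟩⟩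
  have hδ : ∃ δ : ℝ, 0 < δ ∧ ∀ i, δ ≤ l i ∧ (s = Statistics.fermion → l i ≤ 1 - δ) := by
    obtain ⟨i₀, hi₀⟩ := Finite.exists_min l
    obtain ⟨i₁, hi₁⟩ := Finite.exists_max l
    by_cases hs : s = Statistics.fermion
    · refine ⟨min (l i₀) (1 - l i₁), lt_min (hl _) (by linarith [hl' hs i₁]), fun i => ⟨?_, ?_⟩⟩
      · exact (min_le_left _ _).trans (hi₀ i)
      · intro _
        have := min_le_right (l i₀) (1 - l i₁)
        linarith [hi₁ i]
    · exact ⟨l i₀, hl _, fun i => ⟨hi₀ i, fun h => absurd h hs⟩⟩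
  obtain ⟨δ, hδ0, hδ⟩ := hδ
  refine ⟨δ, hδ0, hp.1, ht, fun z => ⟨?_, fun hs => ?_⟩⟩
  · rw [occupation_eq_sum h4, hz, Finset.mul_sum]
    exact Finset.sum_le_sum fun i _ => mul_le_mul_of_nonneg_right (hδ i).1 (sq_nonneg _)
  · rw [occupation_eq_sum h4, hz, Finset.mul_sum]
    exact Finset.sum_le_sum fun i _ => mul_le_mul_of_nonneg_right ((hδ i).2 hs) (sq_nonneg _)

theorem abs_occupation_le (h : OneBody Nb) (z : Fin Nb → ℂ) :
    |occupation h z| ≤ (∑ x, ∑ y, ‖h x y‖) * sqNorm z := by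
  have hz : ∀ x, ‖z x‖ ^ 2 ≤ sqNorm z := fun x =>
    Finset.single_le_sum (f := fun x => ‖z x‖ ^ 2) (fun _ _ => sq_nonneg _) (Finset.mem_univ x)
  refine (Complex.abs_re_le_norm _).trans ?_
  simp only [dotProduct, Matrix.mulVec, Finset.mul_sum, Finset.sum_mul]
  refine (norm_sum_le _ _).trans (Finset.sum_le_sum fun x _ => ?_)
  refine (norm_sum_le _ _).trans (Finset.sum_le_sum fun y _ => ?_)
  rw [norm_mul, norm_mul, Pi.star_apply, norm_star, mul_left_comm]
  refine mul_le_mul_of_nonneg_left ?_ (norm_nonneg _)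
  nlinarith [hz x, hz y, sq_nonneg (‖z x‖ - ‖z y‖)]

theorem UniformlyFractional.add {δ : ℝ} {γ h : OneBody Nb} (hγ : UniformlyFractional s N δ γ)
    (hh : h ∈ traceless Nb) (hb : ∑ x, ∑ y, ‖h x y‖ ≤ δ / 2) :
    UniformlyFractional s N (δ / 2) (γ + h) := by
  refine ⟨hγ.1.add hh.1, by rw [Matrix.trace_add, hγ.2.1, hh.2, add_zero], fun z => ?_⟩
  have h1 := (abs_occupation_le h z).trans (mul_le_mul_of_nonneg_right hb (sqNorm_nonneg z))
  have h2 := abs_le.1 h1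
  rw [occupation_add]
  refine ⟨?_, fun hs => ?_⟩
  · linarith [(hγ.2.2 z).1]
  · linarith [(hγ.2.2 z).2 hs]

/-- Summing l i - μ gives -nμ, which bounds n|μ|. This is how trace zero enters coercivity:
distances from an arbitrary level μ control the whole potential. -/
theorem sum_abs_le_of_sum_eq_zero {n : ℕ} {l : Fin n → ℝ} (hl : ∑ i, l i = 0) (μ : ℝ) :
    ∑ i, |l i| ≤ 2 * ∑ i, |l i - μ| := by
  have h1 : n * |μ| ≤ ∑ i, |l i - μ| := by
    have : ∑ i, (l i - μ) = -(n * μ) := by simp [Finset.sum_sub_distrib, hl]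
    calc n * |μ| = |∑ i, (l i - μ)| := by rw [this, abs_neg, abs_mul, Nat.abs_cast]
      _ ≤ _ := Finset.abs_sum_le_sum_abs _ _
  have h2 : ∑ i, |l i| ≤ ∑ i, (|l i - μ| + |μ|) := by
    refine Finset.sum_le_sum fun i _ => ?_
    calc |l i| = |(l i - μ) + μ| := by rw [sub_add_cancel]
      _ ≤ _ := abs_add_le _ _
  rw [Finset.sum_add_distrib, Finset.sum_const, Finset.card_univ, Fintype.card_fin,
    nsmul_eq_mul] at h2
  linarith

/-- Filling the lowest levels lies strictly below a uniformly fractional occupation. -/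
theorem exists_lowest_filling (hNb : 1 ≤ Nb) (hs : s = Statistics.fermion → N < Nb) {δ : ℝ}
    {l n : Fin Nb → ℝ} (hn : ∀ i, δ ≤ n i) (hn' : s = Statistics.fermion → ∀ i, n i ≤ 1 - δ)
    (hN : ∑ i, n i = N) :
    ∃ (f : Fin N → Fin Nb) (μ : ℝ), (s = Statistics.fermion → Function.Injective f) ∧
      δ * ∑ i, |l i - μ| ≤ ∑ i, l i * n i - ∑ k, l (f k) := by
  -- Both occupations hold N particles, so shifting all levels by μ leaves the energy difference
  -- unchanged.
  have hshift : ∀ μ, ∑ i, l i * n i = ∑ i, (l i - μ) * n i + μ * N := by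
    intro μ
    simp only [sub_mul, Finset.sum_sub_distrib, ← Finset.mul_sum, hN]
    ring
  cases s with
  | boson =>
    have : Nonempty (Fin Nb) := ⟨⟨0, hNb⟩⟩
    obtain ⟨i₀, h₀⟩ := Finite.exists_min l
    refine ⟨fun _ => i₀, l i₀, by simp, ?_⟩
    rw [hshift (l i₀), Finset.sum_const, Finset.card_univ, Fintype.card_fin, nsmul_eq_mul,
      Finset.mul_sum]
    have : ∑ i, δ * |l i - l i₀| ≤ ∑ i, (l i - l i₀) * n i := by
      refine Finset.sum_le_sum fun i _ => ?_
      have h := sub_nonneg.2 (h₀ i)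
      rw [abs_of_nonneg h, mul_comm]
      exact mul_le_mul_of_nonneg_left (hn i) h
    linarith
  | fermion =>
    have hlt := hs rfl
    set σ := Tuple.sort l
    have hσ : Monotone (l ∘ σ) := Tuple.monotone_sort l
    -- The sorted levels are indexed from 0, so index N is the lowest empty level.
    set μ := l (σ ⟨N, hlt⟩)
    refine ⟨fun k => σ (Fin.castLE hlt.le k), μ,
      fun _ => σ.injective.comp (Fin.castLE_injective _), ?_⟩
    have h1 : ∑ k : Fin N, (l (σ (Fin.castLE hlt.le k)) - μ) =
        ∑ j : Fin Nb, if (j : ℕ) < N then l (σ j) - μ else 0 := by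
      refine Fintype.sum_of_injective (Fin.castLE hlt.le) (Fin.castLE_injective _) _ _ ?_ ?_
      · intro j hj
        refine if_neg fun h => hj ⟨⟨j, h⟩, rfl⟩
      · intro k
        simp
    rw [Finset.sum_sub_distrib, Finset.sum_const, Finset.card_univ, Fintype.card_fin,
      nsmul_eq_mul] at h1
    -- A filled level contributes (μ - l)(1 - n), an empty one (l - μ)n; each is at least δ|l - μ|.
    have h2 : ∑ j, δ * |l (σ j) - μ| ≤
        ∑ j, ((l (σ j) - μ) * n (σ j) - if (j : ℕ) < N then l (σ j) - μ else 0) := by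
      refine Finset.sum_le_sum fun j _ => ?_
      split_ifs with hj
      · have h : l (σ j) - μ ≤ 0 := sub_nonpos.2 (hσ (Fin.le_def.2 hj.le))
        rw [abs_of_nonpos h]
        nlinarith [hn' rfl (σ j)]
      · have h : 0 ≤ l (σ j) - μ := sub_nonneg.2 (hσ (Fin.le_def.2 (not_lt.1 hj)))
        rw [abs_of_nonneg h, sub_zero, mul_comm]
        exact mul_le_mul_of_nonneg_left (hn _) h
    rw [Finset.sum_sub_distrib, ← h1, ← Finset.mul_sum,
      Equiv.sum_comp σ fun i => (l i - μ) * n i, Equiv.sum_comp σ fun i => |l i - μ|] at h2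
    rw [hshift μ]
    linarith

theorem trace_mul_eq_sum_occupation {v γ : OneBody Nb} {u : Fin Nb → Fin Nb → ℂ}
    {l : Fin Nb → ℝ} (h : ∀ x y, v x y = ∑ i, l i * u i x * (starRingEnd ℂ) (u i y)) :
    (v * γ).trace.re = ∑ i, l i * occupation γ (u i) := by
  have : (v * γ).trace = ∑ i, (l i : ℂ) * (star (u i) ⬝ᵥ γ.mulVec (u i)) := by
    simp only [Matrix.trace, Matrix.diag_apply, Matrix.mul_apply, h, dotProduct, Matrix.mulVec,
      Finset.sum_mul, Finset.mul_sum]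
    conv_lhs =>
      enter [2, x]
      rw [Finset.sum_comm]
    rw [Finset.sum_comm]
    refine Finset.sum_congr rfl fun i _ => ?_
    rw [Finset.sum_comm]
    refine Finset.sum_congr rfl fun x _ => Finset.sum_congr rfl fun y _ => ?_
    change _ = _ * ((starRingEnd ℂ) _ * _)
    ring
  rw [this, Complex.re_sum]
  exact Finset.sum_congr rfl fun i _ => Complex.re_ofReal_mul _ _

/-- The sum of the moduli of the entries. -/
def entrySum (v : OneBody Nb) : ℝ := ∑ x, ∑ y, ‖v x y‖

theorem entrySum_nonneg (v : OneBody Nb) : 0 ≤ entrySum v :=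
  Finset.sum_nonneg fun _ _ => Finset.sum_nonneg fun _ _ => norm_nonneg _

theorem eq_zero_of_entrySum_eq_zero {v : OneBody Nb} (h : entrySum v = 0) : v = 0 := by
  ext x y
  have h1 := (Finset.sum_eq_zero_iff_of_nonneg
    (fun x _ => Finset.sum_nonneg fun y _ => norm_nonneg (v x y))).1 h x (Finset.mem_univ _)
  exact norm_eq_zero.1 ((Finset.sum_eq_zero_iff_of_nonneg
    (fun y _ => norm_nonneg (v x y))).1 h1 y (Finset.mem_univ _))

theorem entrySum_le {v : OneBody Nb} {u : Fin Nb → Fin Nb → ℂ} {l : Fin Nb → ℝ}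
    (hu : ∀ i, sqNorm (u i) = 1)
    (h : ∀ x y, v x y = ∑ i, l i * u i x * (starRingEnd ℂ) (u i y)) :
    entrySum v ≤ Nb * (Nb * ∑ i, |l i|) := by
  have h1 : ∀ i x, ‖u i x‖ ≤ 1 := by
    intro i x
    have : ‖u i x‖ ^ 2 ≤ 1 := by
      rw [← hu i]
      exact Finset.single_le_sum (f := fun x => ‖u i x‖ ^ 2) (fun _ _ => sq_nonneg _)
        (Finset.mem_univ x)
    exact (sq_le_one_iff₀ (norm_nonneg _)).1 this
  have h2 : ∀ x y, ‖v x y‖ ≤ ∑ i, |l i| := by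
    intro x y
    rw [h]
    refine (norm_sum_le _ _).trans (Finset.sum_le_sum fun i _ => ?_)
    rw [norm_mul, norm_mul, RCLike.norm_conj, Complex.norm_real, Real.norm_eq_abs, mul_assoc]
    exact mul_le_of_le_one_right (abs_nonneg _)
      (mul_le_one₀ (h1 i x) (norm_nonneg _) (h1 i y))
  calc entrySum v ≤ ∑ _x : Fin Nb, ∑ _y : Fin Nb, ∑ i, |l i| :=
        Finset.sum_le_sum fun x _ => Finset.sum_le_sum fun y _ => h2 x y
    _ = _ := by simp

/-- Some state has lower potential energy than a uniformly fractional 1RDM, by an amount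
proportional to the strength of the potential. -/
theorem exists_state_potential_le (hNb : 1 ≤ Nb) (hs : s = Statistics.fermion → N < Nb) {δ : ℝ}
    (hδ : 0 < δ) {γ : OneBody Nb} (hγ : UniformlyFractional s N δ γ) {v : OneBody Nb}
    (hv : v ∈ traceless Nb) : ∃ ψ : NParticle s Nb N, ‖ψ‖ = 1 ∧
      (inner ℂ ψ (potential s N v ψ)).re + δ / (2 * (Nb * Nb)) * entrySum v ≤
        (v * γ).trace.re := by
  obtain ⟨u, l, h1, h2, h3, h4⟩ := exists_orthonormal_eigenvectors hv.1
  have hu : ∀ i, sqNorm (u i) = 1 := by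
    intro i
    have : (sqNorm (u i) : ℂ) = 1 := by
      rw [← sum_mul_conj_eq_sqNorm]
      have := h1 i i
      rw [if_pos rfl] at this
      rw [← this]
      exact Finset.sum_congr rfl fun _ _ => mul_comm _ _
    exact_mod_cast this
  have hone : ∀ x y, (1 : OneBody Nb) x y =
      ∑ i, ((1 : ℝ) : ℂ) * u i x * (starRingEnd ℂ) (u i y) := by
    intro x y
    simp [h2, Matrix.one_apply]
  have hN : ∑ i, occupation γ (u i) = N := by
    have := trace_mul_eq_sum_occupation (γ := γ) (l := fun _ => 1) hone
    rw [Matrix.one_mul, hγ.2.1] at this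
    simpa using this.symm
  have hl : ∑ i, l i = 0 := by
    have := trace_mul_eq_sum_occupation (γ := 1) h4
    rw [Matrix.mul_one, hv.2] at this
    simpa [occupation_one, hu] using this.symm
  obtain ⟨f, μ, hf, hgap⟩ := exists_lowest_filling (s := s) hNb hs (l := l)
    (n := fun i => occupation γ (u i)) (δ := δ)
    (fun i => by simpa [hu] using (hγ.2.2 (u i)).1)
    (fun hfe i => by simpa [hu] using (hγ.2.2 (u i)).2 hfe) hN
  rw [← trace_mul_eq_sum_occupation h4] at hgap
  set φ := symmetrizedProduct s u f
  have hφ : φ ≠ 0 := symmetrizedProduct_ne_zero h1 hf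
  have hφ' : potential s N v φ = ((∑ k, l (f k) : ℝ) : ℂ) • φ := potential_symmetrizedProduct h3 f
  set ψ : NParticle s Nb N := ((‖φ‖⁻¹ : ℝ) : ℂ) • φ
  have hψ : ‖ψ‖ = 1 := by
    rw [norm_smul, Complex.norm_real, norm_inv, norm_norm, inv_mul_cancel₀ (norm_ne_zero_iff.2 hφ)]
  have hψ' : potential s N v ψ = ((∑ k, l (f k) : ℝ) : ℂ) • ψ := by
    rw [map_smul, hφ', smul_comm]
  refine ⟨ψ, hψ, ?_⟩
  rw [hψ', inner_smul_right, inner_self_eq_norm_sq_to_K, hψ]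
  have h5 := entrySum_le hu h4
  have h6 := sum_abs_le_of_sum_eq_zero hl μ
  have hNb' : (0 : ℝ) < Nb := by exact_mod_cast hNb
  -- The factor Nb² comes from `entrySum_le`, the factor 2 from `sum_abs_le_of_sum_eq_zero`.
  have h7 : δ / (2 * (Nb * Nb)) * entrySum v ≤ δ * ∑ i, |l i - μ| := by
    calc δ / (2 * (Nb * Nb)) * entrySum v ≤
        δ / (2 * (Nb * Nb)) * (Nb * (Nb * (2 * ∑ i, |l i - μ|))) := by
          gcongr
          exact h5.trans (by gcongr)
      _ = _ := by field_simp
  simp only [Complex.coe_algebraMap, Complex.ofReal_one, one_pow, mul_one, Complex.ofReal_re]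
  linarith

/-! ### The free energy as a function of the potential, and its duality with the universal
functional. -/

section FreeEnergy

variable {β : ℝ} {H₀ : Operator s Nb N}

theorem isSelfAdjoint_hamiltonian (hH₀ : IsSelfAdjoint H₀) {v : OneBody Nb}
    (hv : v.IsHermitian) : IsSelfAdjoint (hamiltonian H₀ v) :=
  hH₀.add (isSelfAdjoint_potential hv)

theorem helmholtz_eq_add (v w : OneBody Nb) (ρ : Operator s Nb N) :
    helmholtz H₀ β w ρ = helmholtz H₀ β v ρ + ((w - v) * rdm ρ).trace.re := by
  have : hamiltonian H₀ w = hamiltonian H₀ v + potential s N (w - v) := by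
    rw [hamiltonian, hamiltonian, potential_sub]
    abel
  rw [helmholtz, helmholtz, this, mul_add, Tr_add, Tr_mul_potential, Complex.add_re]
  ring

theorem gibbs_mem [Nontrivial (NParticle s Nb N)] (hH₀ : IsSelfAdjoint H₀) {v : OneBody Nb}
    (hv : v.IsHermitian) : gibbs H₀ β v ∈ densityOperators s Nb N :=
  thermalState_mem β (isSelfAdjoint_hamiltonian hH₀ hv)

theorem helmholtz_gibbs [Nontrivial (NParticle s Nb N)] (hβ : 0 < β) (hH₀ : IsSelfAdjoint H₀)
    {v : OneBody Nb} (hv : v.IsHermitian) :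
    helmholtz H₀ β v (gibbs H₀ β v) = freeEnergy β (hamiltonian H₀ v) :=
  helmholtz_thermalState hβ (isSelfAdjoint_hamiltonian hH₀ hv)

theorem freeEnergy_le_helmholtz [Nontrivial (NParticle s Nb N)] (hβ : 0 < β)
    (hH₀ : IsSelfAdjoint H₀) {v : OneBody Nb} (hv : v.IsHermitian) {ρ : Operator s Nb N}
    (hρ : ρ ∈ densityOperators s Nb N) :
    freeEnergy β (hamiltonian H₀ v) ≤ helmholtz H₀ β v ρ :=
  freeEnergy_le hβ (isSelfAdjoint_hamiltonian hH₀ hv) hρ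

/-- The 1RDM of the Gibbs state is a supergradient of the free energy. -/
theorem freeEnergy_le_add [Nontrivial (NParticle s Nb N)] (hβ : 0 < β) (hH₀ : IsSelfAdjoint H₀)
    {v w : OneBody Nb} (hv : v.IsHermitian) (hw : w.IsHermitian) :
    freeEnergy β (hamiltonian H₀ w) ≤
      freeEnergy β (hamiltonian H₀ v) + ((w - v) * rdm (gibbs H₀ β v)).trace.re := by
  have := freeEnergy_le_helmholtz hβ hH₀ hw (gibbs_mem (β := β) hH₀ hv)
  rwa [helmholtz_eq_add v w, helmholtz_gibbs hβ hH₀ hv] at this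

/-- The low-lying state of `exists_state_potential_le` bounds the free energy from above; `H₀` adds
at most its norm. -/
theorem freeEnergy_coercive (hNb : 1 ≤ Nb) (hs : s = Statistics.fermion → N < Nb) (hβ : 0 < β)
    (hH₀ : IsSelfAdjoint H₀) {δ : ℝ} (hδ : 0 < δ) {γ : OneBody Nb}
    (hγ : UniformlyFractional s N δ γ) {v : OneBody Nb} (hv : v ∈ traceless Nb) :
    freeEnergy β (hamiltonian H₀ v) + δ / (2 * (Nb * Nb)) * entrySum v ≤
      ‖H₀‖ + (v * γ).trace.re := by
  have := nontrivial_nParticle (s := s) hNb hs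
  obtain ⟨ψ, hψ, h⟩ := exists_state_potential_le hNb hs hδ hγ hv
  have h1 := freeEnergy_le_inner hβ (isSelfAdjoint_hamiltonian hH₀ hv.1) hψ
  have h2 : (inner ℂ ψ (H₀ ψ)).re ≤ ‖H₀‖ := by
    refine (Complex.re_le_norm _).trans ((norm_inner_le_norm _ _).trans ?_)
    rw [hψ, one_mul]
    simpa [hψ] using H₀.le_opNorm ψ
  rw [hamiltonian, add_apply, inner_add_right, Complex.add_re] at h1
  rw [hamiltonian]
  linarith

/-- The exponentials are positive multiples of each other; the logarithm turns the factor into an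
additive constant. -/
theorem exists_potential_sub_eq_smul_one (hβ : 0 < β) {v w : OneBody Nb}
    [Nontrivial (NParticle s Nb N)] (hH₀ : IsSelfAdjoint H₀) (hv : v.IsHermitian)
    (hw : w.IsHermitian) (h : gibbs H₀ β v = gibbs H₀ β w) :
    ∃ c : ℂ, potential s N (v - w) = c • 1 := by
  have hHv := isSelfAdjoint_hamiltonian hH₀ hv
  have hHw := isSelfAdjoint_hamiltonian hH₀ hw
  have hZ : ∀ {H : Operator s Nb N}, IsSelfAdjoint H → ∃ Z : ℝ, 0 < Z ∧
      Tr (NormedSpace.exp (-(β : ℂ) • H)) = Z := by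
    intro H hH
    obtain ⟨f, l, hf⟩ := exists_eigenbasis hH
    have : Nonempty (Fin (Module.finrank ℂ (NParticle s Nb N))) := ⟨⟨0, Module.finrank_pos⟩⟩
    exact ⟨_, sum_exp_pos _, Tr_exp_eq hH f hf⟩
  obtain ⟨Zv, hZv, hv'⟩ := hZ hHv
  obtain ⟨Zw, hZw, hw'⟩ := hZ hHw
  have he : NormedSpace.exp (-(β : ℂ) • hamiltonian H₀ v) =
      (Zv / Zw) • NormedSpace.exp (-(β : ℂ) • hamiltonian H₀ w) := by
    rw [gibbs, gibbs, hv', hw'] at h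
    have h' := congrArg (fun A : Operator s Nb N => (Zv : ℂ) • A) h
    simp only [smul_smul] at h'
    rw [mul_inv_cancel₀ (by exact_mod_cast hZv.ne'), one_smul] at h'
    rw [h', ← Complex.coe_smul, div_eq_mul_inv]
    push_cast
    rfl
  have hSv := isSelfAdjoint_neg_smul β hHv
  have hSw := isSelfAdjoint_neg_smul β hHw
  have hlog := congrArg CFC.log he
  rw [CFC.log_exp _ hSv, CFC.log_smul _ ?_ (div_pos hZv hZw).ne' ?_, CFC.log_exp _ hSw,
    Algebra.algebraMap_eq_smul_one] at hlog
  · refine ⟨-(β : ℂ)⁻¹ * (Real.log (Zv / Zw) : ℝ), ?_⟩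
    have hβ' : (β : ℂ) ≠ 0 := by exact_mod_cast hβ.ne'
    have h3 : (-(β : ℂ)) • potential s N (v - w) = ((Real.log (Zv / Zw) : ℝ) : ℂ) • 1 := by
      rw [Complex.coe_smul, ← sub_eq_of_eq_add hlog, ← smul_sub, hamiltonian, hamiltonian,
        add_sub_add_left_eq_sub, potential_sub]
    rw [mul_smul, ← h3, smul_smul]
    have : -(β : ℂ)⁻¹ * -(β : ℂ) = 1 := by field_simp
    rw [this, one_smul]
  · intro x hx hx0
    rw [← CFC.real_exp_eq_normedSpace_exp hSw,
      cfc_map_spectrum Real.exp (-(β : ℂ) • hamiltonian H₀ w) hSw] at hx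
    obtain ⟨y, -, hy⟩ := hx
    exact (Real.exp_pos y).ne' (hy.trans hx0)
  · rw [← CFC.real_exp_eq_normedSpace_exp hSw]
    exact cfc_predicate _ _

/-- The Hohenberg–Kohn argument: with equal 1RDMs, the Gibbs state of v also minimises the Helmholtz
functional at w, so by uniqueness the Gibbs states agree. Then v - w is a scalar of trace zero. -/
theorem rdm_gibbs_injective (hNb : 1 ≤ Nb) (hN : 1 ≤ N) (hs : s = Statistics.fermion → N < Nb)
    (hβ : 0 < β) (hH₀ : IsSelfAdjoint H₀) {v w : OneBody Nb} (hv : v ∈ traceless Nb)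
    (hw : w ∈ traceless Nb) (h : rdm (gibbs H₀ β v) = rdm (gibbs H₀ β w)) : v = w := by
  have := nontrivial_nParticle (s := s) hNb hs
  have hg : gibbs H₀ β v = gibbs H₀ β w := by
    refine eq_thermalState_of_le hβ (isSelfAdjoint_hamiltonian hH₀ hw.1)
      (gibbs_mem hH₀ hv.1) ?_
    change helmholtz H₀ β w _ ≤ _
    rw [helmholtz_eq_add v w, helmholtz_gibbs hβ hH₀ hv.1]
    have h1 := freeEnergy_le_add hβ hH₀ hw.1 hv.1
    rw [← h, ← neg_sub w v, Matrix.neg_mul, Matrix.trace_neg, Complex.neg_re] at h1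
    linarith
  obtain ⟨c, hc⟩ := exists_potential_sub_eq_smul_one hβ hH₀ hv.1 hw.1 hg
  obtain ⟨a, ha, -⟩ := eq_smul_one_of_potential_eq_smul_one (s := s) hNb hN hs (hv.1.sub hw.1) hc
  have ht : (v - w).trace = 0 := by rw [Matrix.trace_sub, hv.2, hw.2, sub_zero]
  rw [ha, Matrix.trace_smul, Matrix.trace_one, Fintype.card_fin, smul_eq_mul] at ht
  have ha0 : a = 0 := (mul_eq_zero.1 ht).resolve_right (by exact_mod_cast (by omega : Nb ≠ 0))
  rw [ha0, zero_smul] at ha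
  exact sub_eq_zero.1 ha

theorem le_universalFunctional [Nontrivial (NParticle s Nb N)] (hβ : 0 < β)
    (hH₀ : IsSelfAdjoint H₀) {v : OneBody Nb} (hv : v.IsHermitian) (γ : OneBody Nb) :
    ((freeEnergy β (hamiltonian H₀ v) - (v * γ).trace.re : ℝ) : EReal) ≤
      universalFunctional H₀ β γ := by
  refine le_iInf₂ fun ρ hρ => ?_
  have := freeEnergy_le_helmholtz hβ hH₀ hv hρ.1
  rw [helmholtz_eq_add 0 v, hρ.2, sub_zero] at this
  exact EReal.coe_le_coe_iff.2 (by linarith)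

theorem universalFunctional_rdm_gibbs [Nontrivial (NParticle s Nb N)] (hβ : 0 < β)
    (hH₀ : IsSelfAdjoint H₀) {v : OneBody Nb} (hv : v.IsHermitian) :
    universalFunctional H₀ β (rdm (gibbs H₀ β v)) =
      ((freeEnergy β (hamiltonian H₀ v) - (v * rdm (gibbs H₀ β v)).trace.re : ℝ) : EReal) := by
  refine le_antisymm ?_ (le_universalFunctional hβ hH₀ hv _)
  refine (iInf₂_le (gibbs H₀ β v) ⟨gibbs_mem hH₀ hv, rfl⟩).trans ?_
  have := helmholtz_eq_add (H₀ := H₀) (β := β) 0 v (gibbs H₀ β v)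
  rw [helmholtz_gibbs hβ hH₀ hv, sub_zero] at this
  exact EReal.coe_le_coe_iff.2 (by linarith)

end FreeEnergy

-- Topology of the potentials and continuity of the Gibbs state.

attribute [local instance] Matrix.frobeniusNormedAddCommGroup Matrix.frobeniusNormedSpace

instance : ProperSpace (traceless Nb) := FiniteDimensional.proper ℝ _

theorem continuous_entry (x y : Fin Nb) :
    Continuous fun v : traceless Nb => (v : OneBody Nb) x y := by
  let L : traceless Nb →ₗ[ℝ] ℂ :=
    { toFun := fun v => (v : OneBody Nb) x y
      map_add' := fun _ _ => rfl
      map_smul' := fun _ _ => rfl }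
  exact L.continuous_of_finiteDimensional

theorem continuous_entrySum : Continuous fun v : traceless Nb => entrySum (v : OneBody Nb) :=
  continuous_finsetSum _ fun x _ => continuous_finsetSum _ fun y _ => (continuous_entry x y).norm

theorem exists_norm_le_entrySum :
    ∃ K : ℝ, 0 < K ∧ ∀ v : traceless Nb, ‖v‖ ≤ K * entrySum (v : OneBody Nb) := by
  set c : Fin Nb → Fin Nb → ℝ := fun x y => ‖(Matrix.single x y 1 : OneBody Nb)‖
  -- The summand 1 keeps the constant positive even for `Nb = 0`.
  refine ⟨1 + ∑ x, ∑ y, c x y, by positivity, fun v => ?_⟩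
  have hc : ∀ x y, c x y ≤ 1 + ∑ x, ∑ y, c x y := by
    intro x y
    have h1 : c x y ≤ ∑ y, c x y := Finset.single_le_sum (f := fun y => c x y)
      (fun _ _ => norm_nonneg _) (Finset.mem_univ y)
    have h2 : ∑ y, c x y ≤ ∑ x, ∑ y, c x y := Finset.single_le_sum (f := fun x => ∑ y, c x y)
      (fun _ _ => Finset.sum_nonneg fun _ _ => norm_nonneg _) (Finset.mem_univ x)
    linarith
  change ‖(v : OneBody Nb)‖ ≤ _
  conv_lhs => rw [Matrix.matrix_eq_sum_single (v : OneBody Nb)]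
  rw [entrySum, Finset.mul_sum]
  refine (norm_sum_le _ _).trans (Finset.sum_le_sum fun x _ => ?_)
  rw [Finset.mul_sum]
  refine (norm_sum_le _ _).trans (Finset.sum_le_sum fun y _ => ?_)
  have : (Matrix.single x y ((v : OneBody Nb) x y) : OneBody Nb) =
      (v : OneBody Nb) x y • (Matrix.single x y 1 : OneBody Nb) := by
    rw [Matrix.smul_single, smul_eq_mul, mul_one]
  rw [this, norm_smul, mul_comm]
  exact mul_le_mul_of_nonneg_right (hc x y) (norm_nonneg _)

section Continuity

variable {β : ℝ} {H₀ : Operator s Nb N}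

theorem continuous_hamiltonian :
    Continuous fun v : traceless Nb => hamiltonian H₀ (v : OneBody Nb) :=
  continuous_const.add <| continuous_finsetSum _ fun x _ => continuous_finsetSum _ fun y _ =>
    (continuous_entry x y).smul continuous_const

theorem continuous_exp_hamiltonian :
    Continuous fun v : traceless Nb =>
      NormedSpace.exp (-(β : ℂ) • hamiltonian H₀ (v : OneBody Nb)) := by
  let : NormedAlgebra ℚ (Operator s Nb N) := NormedAlgebra.restrictScalars ℚ ℂ _
  have h : Continuous fun v : traceless Nb => -(β : ℂ) • hamiltonian H₀ (v : OneBody Nb) :=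
    Continuous.smul (f := fun _ => -(β : ℂ)) continuous_const continuous_hamiltonian
  exact NormedSpace.exp_continuous.comp h

theorem re_Tr_exp_pos [Nontrivial (NParticle s Nb N)] {H : Operator s Nb N}
    (hH : IsSelfAdjoint H) : 0 < (Tr (NormedSpace.exp (-(β : ℂ) • H))).re := by
  obtain ⟨f, l, hf⟩ := exists_eigenbasis hH
  have : Nonempty (Fin (Module.finrank ℂ (NParticle s Nb N))) := ⟨⟨0, Module.finrank_pos⟩⟩
  rw [Tr_exp_eq hH f hf, Complex.ofReal_re]
  exact sum_exp_pos _

theorem continuous_freeEnergy [Nontrivial (NParticle s Nb N)] (hH₀ : IsSelfAdjoint H₀) :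
    Continuous fun v : traceless Nb => freeEnergy β (hamiltonian H₀ (v : OneBody Nb)) := by
  refine continuous_const.mul (Continuous.log
    (Complex.continuous_re.comp (continuous_Tr.comp continuous_exp_hamiltonian)) fun v => ?_)
  exact (re_Tr_exp_pos (isSelfAdjoint_hamiltonian hH₀ v.2.1)).ne'

theorem continuous_gibbs [Nontrivial (NParticle s Nb N)] (hH₀ : IsSelfAdjoint H₀) :
    Continuous fun v : traceless Nb => gibbs H₀ β (v : OneBody Nb) := by
  refine Continuous.smul (Continuous.inv₀ (continuous_Tr.comp continuous_exp_hamiltonian)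
    fun v h => ?_) continuous_exp_hamiltonian
  have := re_Tr_exp_pos (β := β) (isSelfAdjoint_hamiltonian hH₀ v.2.1)
  simp only [Function.comp_apply] at h
  rw [h] at this
  exact lt_irrefl _ this

theorem continuous_rdm_gibbs_apply [Nontrivial (NParticle s Nb N)] (hH₀ : IsSelfAdjoint H₀)
    (x y : Fin Nb) :
    Continuous fun v : traceless Nb => rdm (gibbs H₀ β (v : OneBody Nb)) x y :=
  continuous_Tr.comp ((continuous_gibbs hH₀).mul continuous_const)

end Continuity

/-! ### Representability and differentiability. -/

theorem tracePairing_apply (w : OneBody Nb) (h : traceless Nb) :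
    tracePairing w h = (w * (h : OneBody Nb)).trace.re := rfl

theorem norm_entry_le (h : OneBody Nb) (x y : Fin Nb) : ‖h x y‖ ≤ ‖h‖ := by
  rw [Matrix.frobenius_norm_def, ← Real.sqrt_eq_rpow]
  refine Real.le_sqrt_of_sq_le ?_
  simp only [Real.rpow_ofNat]
  have h1 : ‖h x y‖ ^ 2 ≤ ∑ y, ‖h x y‖ ^ 2 := Finset.single_le_sum
    (f := fun y => ‖h x y‖ ^ 2) (fun _ _ => sq_nonneg _) (Finset.mem_univ y)
  exact h1.trans (Finset.single_le_sum (f := fun x => ∑ y, ‖h x y‖ ^ 2)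
    (fun _ _ => Finset.sum_nonneg fun _ _ => sq_nonneg _) (Finset.mem_univ x))

theorem re_trace_mul_le (a : OneBody Nb) (h : traceless Nb) :
    (a * (h : OneBody Nb)).trace.re ≤ entrySum a * ‖h‖ := by
  refine (Complex.re_le_norm _).trans ?_
  simp only [Matrix.trace, Matrix.diag_apply, Matrix.mul_apply, entrySum, Finset.sum_mul]
  refine (norm_sum_le _ _).trans (Finset.sum_le_sum fun x _ => ?_)
  refine (norm_sum_le _ _).trans (Finset.sum_le_sum fun y _ => ?_)
  rw [norm_mul]
  exact mul_le_mul_of_nonneg_left (norm_entry_le _ _ _) (norm_nonneg _)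

section Main

variable {β : ℝ} {H₀ : Operator s Nb N}

/-- Test with w = γ - γ' itself: the trace is the sum of the squared moduli of its entries. -/
theorem eq_of_forall_trace_mul_sub_nonpos {γ γ' : OneBody Nb} (h : γ - γ' ∈ traceless Nb)
    (hle : ∀ w ∈ traceless Nb, (w * (γ - γ')).trace.re ≤ 0) : γ = γ' := by
  have h1 := hle _ h
  set d := γ - γ' with hd
  have h2 : (d * d).trace = ((∑ x, ∑ y, ‖d x y‖ ^ 2 : ℝ) : ℂ) := by
    push_cast
    simp only [Matrix.trace, Matrix.diag_apply, Matrix.mul_apply]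
    refine Finset.sum_congr rfl fun x _ => Finset.sum_congr rfl fun y _ => ?_
    rw [← Complex.mul_conj', ← h.1.apply y x]
    rfl
  rw [h2, Complex.ofReal_re] at h1
  have h3 := le_antisymm h1 (Finset.sum_nonneg fun _ _ => Finset.sum_nonneg fun _ _ => sq_nonneg _)
  have h4 : d = 0 := by
    ext x y
    have h5 := (Finset.sum_eq_zero_iff_of_nonneg
      (fun x _ => Finset.sum_nonneg fun y _ => sq_nonneg ‖d x y‖)).1 h3 x (Finset.mem_univ _)
    have h6 := (Finset.sum_eq_zero_iff_of_nonneg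
      (fun y _ => sq_nonneg ‖d x y‖)).1 h5 y (Finset.mem_univ _)
    simpa using h6
  exact sub_eq_zero.1 h4

theorem sub_mem_traceless {γ γ' : OneBody Nb} (h : γ.IsHermitian) (h' : γ'.IsHermitian)
    (ht : γ.trace = γ'.trace) : γ - γ' ∈ traceless Nb :=
  ⟨h.sub h', by rw [Matrix.trace_sub, ht, sub_self]⟩

theorem rdm_gibbs_mem_fractionalRDMs (hNb : 1 ≤ Nb) (hN : 1 ≤ N)
    (hs : s = Statistics.fermion → N < Nb) (hH₀ : IsSelfAdjoint H₀) {v : OneBody Nb}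
    (hv : v ∈ traceless Nb) : rdm (gibbs H₀ β v) ∈ fractionalRDMs s Nb N := by
  have := nontrivial_nParticle (s := s) hNb hs
  have hH := isSelfAdjoint_hamiltonian hH₀ hv.1
  obtain ⟨c, hc, h⟩ := thermalState_pos β hH
  exact rdm_mem_fractionalRDMs hNb hN hs (isSelfAdjoint_thermalState β hH)
    (thermalState_mem β hH).2 hc h

/-- Uniformly fractional 1RDMs are `v`-representable. -/
theorem exists_rdm_gibbs_eq (hNb : 1 ≤ Nb) (hs : s = Statistics.fermion → N < Nb) (hβ : 0 < β)
    (hH₀ : IsSelfAdjoint H₀) {δ : ℝ} (hδ : 0 < δ) {γ : OneBody Nb}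
    (hγ : UniformlyFractional s N δ γ) : ∃ v ∈ traceless Nb, rdm (gibbs H₀ β v) = γ := by
  have := nontrivial_nParticle (s := s) hNb hs
  have hNb' : (0 : ℝ) < Nb := by exact_mod_cast hNb
  set Φ : traceless Nb → ℝ := fun v =>
    ((v : OneBody Nb) * γ).trace.re - freeEnergy β (hamiltonian H₀ (v : OneBody Nb))
  have hΦ : Continuous Φ := by
    refine Continuous.sub (Complex.continuous_re.comp ?_) (continuous_freeEnergy hH₀)
    simp only [Matrix.trace, Matrix.diag_apply, Matrix.mul_apply]
    exact continuous_finsetSum _ fun x _ => continuous_finsetSum _ fun y _ =>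
      (continuous_entry x y).mul continuous_const
  obtain ⟨K, hK, hKn⟩ := exists_norm_le_entrySum (Nb := Nb)
  set a := δ / (2 * (Nb * Nb))
  have ha : 0 < a := by positivity
  have hlow : ∀ v : traceless Nb, a / K * ‖v‖ - ‖H₀‖ ≤ Φ v := by
    intro v
    have h1 := freeEnergy_coercive hNb hs hβ hH₀ hδ hγ v.2
    have h2 : a / K * ‖v‖ ≤ a * entrySum (v : OneBody Nb) := by
      calc a / K * ‖v‖ ≤ a / K * (K * entrySum (v : OneBody Nb)) :=
            mul_le_mul_of_nonneg_left (hKn v) (by positivity)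
        _ = _ := by field_simp
    simp only [Φ]
    linarith
  have hlim : Filter.Tendsto Φ (Filter.cocompact _) Filter.atTop := by
    refine Filter.tendsto_atTop_mono hlow ?_
    exact Filter.tendsto_atTop_add_const_right _ _
      ((tendsto_norm_cocompact_atTop).const_mul_atTop (by positivity))
  obtain ⟨v, hv⟩ := hΦ.exists_forall_le hlim
  refine ⟨v, v.2, ?_⟩
  have hρ := gibbs_mem (β := β) hH₀ v.2.1
  refine eq_of_forall_trace_mul_sub_nonpos
    (sub_mem_traceless (isHermitian_rdm hρ.1.isSelfAdjoint) hγ.1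
      ((trace_rdm hρ.2).trans hγ.2.1.symm)) fun w hw => ?_
  set W : traceless Nb := ⟨w, hw⟩
  -- Minimality of v bounds Ω(v+tW) - Ω(v) above by t tr(wγ), and the supergradient at v+tW bounds
  -- it below by t tr(wγ_{v+tW}). No derivative of Ω is needed.
  have hpos : ∀ t : ℝ, 0 < t →
      (w * (rdm (gibbs H₀ β ((v + t • W : traceless Nb) : OneBody Nb)) - γ)).trace.re ≤ 0 := by
    intro t ht
    have h1 := hv (v + t • W)
    have h2 := freeEnergy_le_add hβ hH₀ (v + t • W).2.1 v.2.1
    have e1 : ((v + t • W : traceless Nb) : OneBody Nb) = (v : OneBody Nb) + (t : ℂ) • w := by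
      rw [Complex.coe_smul]
      rfl
    have e2 : (v : OneBody Nb) - ((v : OneBody Nb) + (t : ℂ) • w) = -((t : ℂ) • w) := by abel
    simp only [Φ, e1] at h1 h2 ⊢
    rw [e2, Matrix.neg_mul, Matrix.smul_mul, Matrix.trace_neg, Matrix.trace_smul, Complex.neg_re,
      smul_eq_mul, Complex.re_ofReal_mul] at h2
    rw [Matrix.add_mul, Matrix.trace_add, Matrix.smul_mul, Matrix.trace_smul, Complex.add_re,
      smul_eq_mul, Complex.re_ofReal_mul] at h1
    rw [Matrix.mul_sub, Matrix.trace_sub, Complex.sub_re]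
    have h3 : t * ((w * rdm (gibbs H₀ β ((v : OneBody Nb) + (t : ℂ) • w))).trace.re -
        (w * γ).trace.re) ≤ 0 := by linarith
    exact nonpos_of_mul_nonpos_right h3 ht
  have hcont : Continuous fun t : ℝ =>
      (w * (rdm (gibbs H₀ β ((v + t • W : traceless Nb) : OneBody Nb)) - γ)).trace.re := by
    refine Complex.continuous_re.comp ?_
    simp only [Matrix.trace, Matrix.diag_apply, Matrix.mul_apply, Matrix.sub_apply]
    refine continuous_finsetSum _ fun x _ => continuous_finsetSum _ fun y _ =>
      continuous_const.mul (Continuous.sub ?_ continuous_const)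
    exact (continuous_rdm_gibbs_apply hH₀ y x).comp
      (continuous_const.add (continuous_id.smul continuous_const))
  -- Let t tend to 0 from above; continuity of the Gibbs 1RDM gives the inequality at v.
  have h0 := le_of_tendsto (hcont.tendsto 0 |>.mono_left (nhdsWithin_le_nhds (s := Set.Ioi 0)))
    (Filter.eventually_of_mem self_mem_nhdsWithin hpos)
  simpa using h0

theorem HasDerivAlong.of_abs_le {F : OneBody Nb → EReal} {J : traceless Nb →L[ℝ] ℝ}
    {γ : OneBody Nb} (hfin : ∀ᶠ h : traceless Nb in 𝓝 0, F (γ + h) ≠ ⊤ ∧ F (γ + h) ≠ ⊥)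
    (hle : ∀ ε : ℝ, 0 < ε → ∀ᶠ h : traceless Nb in 𝓝 0,
      |(F (γ + h)).toReal - (F γ).toReal - J h| ≤ ε * ‖h‖) : HasDerivAlong F J γ := by
  refine ⟨hfin, hasFDerivAt_iff_isLittleO_nhds_zero.2 (Asymptotics.isLittleO_iff.2 ?_)⟩
  intro ε hε
  filter_upwards [hle ε hε] with h hh
  rw [Real.norm_eq_abs, zero_add, ZeroMemClass.coe_zero, add_zero]
  exact hh

theorem eventually_entrySum_lt {ε : ℝ} (hε : 0 < ε) :
    ∀ᶠ h : traceless Nb in 𝓝 0, entrySum (h : OneBody Nb) < ε := by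
  refine (continuous_entrySum.tendsto 0).eventually (gt_mem_nhds ?_)
  simpa [entrySum] using hε

theorem eventually_uniformlyFractional {δ : ℝ} (hδ : 0 < δ) {γ : OneBody Nb}
    (hγ : UniformlyFractional s N δ γ) :
    ∀ᶠ h : traceless Nb in 𝓝 0, UniformlyFractional s N (δ / 2) (γ + (h : OneBody Nb)) := by
  filter_upwards [eventually_entrySum_lt (half_pos hδ)] with h hh
  exact hγ.add h.2 hh.le

/-- Coercivity is applied at the 1RDM of w itself. The supergradient inequality from w to the zero
potential bounds tr(wγ_w) - Ω(w) by -Ω(0), so w cancels from the right-hand side. -/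
theorem norm_le_of_rdm_gibbs_eq (hNb : 1 ≤ Nb) (hs : s = Statistics.fermion → N < Nb)
    (hβ : 0 < β) (hH₀ : IsSelfAdjoint H₀) {δ : ℝ} (hδ : 0 < δ) :
    ∃ R : ℝ, ∀ w : traceless Nb,
      UniformlyFractional s N δ (rdm (gibbs H₀ β (w : OneBody Nb))) → ‖w‖ ≤ R := by
  have := nontrivial_nParticle (s := s) hNb hs
  have hNb' : (0 : ℝ) < Nb := by exact_mod_cast hNb
  obtain ⟨K, hK, hKn⟩ := exists_norm_le_entrySum (Nb := Nb)
  set a := δ / (2 * (Nb * Nb))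
  have ha : 0 < a := by positivity
  refine ⟨K * ((‖H₀‖ - freeEnergy β (hamiltonian H₀ 0)) / a), fun w hw => ?_⟩
  have h1 := freeEnergy_coercive hNb hs hβ hH₀ hδ hw w.2
  have h2 := freeEnergy_le_add hβ hH₀ w.2.1 (traceless Nb).zero_mem.1
  rw [zero_sub, Matrix.neg_mul, Matrix.trace_neg, Complex.neg_re] at h2
  refine (hKn w).trans (mul_le_mul_of_nonneg_left ?_ hK.le)
  rw [le_div_iff₀ ha]
  linarith

/-- The potential depends continuously on the 1RDM of its Gibbs state. -/
theorem eventually_entrySum_sub_lt (hNb : 1 ≤ Nb) (hN : 1 ≤ N)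
    (hs : s = Statistics.fermion → N < Nb) (hβ : 0 < β) (hH₀ : IsSelfAdjoint H₀)
    {v : OneBody Nb} (hv : v ∈ traceless Nb) {δ : ℝ} (hδ : 0 < δ)
    (hγ : UniformlyFractional s N δ (rdm (gibbs H₀ β v))) {ε : ℝ} (hε : 0 < ε) :
    ∀ᶠ h : traceless Nb in 𝓝 0, ∀ w ∈ traceless Nb,
      rdm (gibbs H₀ β w) = rdm (gibbs H₀ β v) + (h : OneBody Nb) → entrySum (v - w) < ε := by
  have := nontrivial_nParticle (s := s) hNb hs
  obtain ⟨R, hR⟩ := norm_le_of_rdm_gibbs_eq hNb hs hβ hH₀ (half_pos hδ)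
  set S : Set (traceless Nb) := Metric.closedBall 0 R ∩
    {w | ε ≤ entrySum (v - (w : OneBody Nb))}
  have hsub : Continuous fun w : traceless Nb => entrySum (v - (w : OneBody Nb)) :=
    continuous_finsetSum _ fun x _ => continuous_finsetSum _ fun y _ =>
      (continuous_const.sub (continuous_entry x y)).norm
  have hS : IsCompact S := (isCompact_closedBall _ _).inter_right
    (isClosed_le continuous_const hsub)
  have hg : Continuous fun w : traceless Nb =>
      entrySum (rdm (gibbs H₀ β (w : OneBody Nb)) - rdm (gibbs H₀ β v)) :=
    continuous_finsetSum _ fun x _ => continuous_finsetSum _ fun y _ =>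
      ((continuous_rdm_gibbs_apply hH₀ x y).sub continuous_const).norm
  -- On the compact set S of bounded potentials at distance at least ε from v, injectivity keeps the
  -- 1RDM a positive distance m from that of v.
  obtain ⟨m, hm, hmS⟩ : ∃ m : ℝ, 0 < m ∧
      ∀ w ∈ S, m ≤ entrySum (rdm (gibbs H₀ β (w : OneBody Nb)) - rdm (gibbs H₀ β v)) := by
    rcases S.eq_empty_or_nonempty with hE | hne
    · exact ⟨1, one_pos, by simp [hE]⟩
    obtain ⟨w₀, hw₀, hmin⟩ := hS.exists_isMinOn hne hg.continuousOn
    refine ⟨_, (entrySum_nonneg _).lt_of_ne fun h0 => ?_, fun w hw => hmin hw⟩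
    have h1 := sub_eq_zero.1 (eq_zero_of_entrySum_eq_zero h0.symm)
    have h2 := rdm_gibbs_injective hNb hN hs hβ hH₀ w₀.2 hv h1
    have h3 : ε ≤ entrySum (v - (w₀ : OneBody Nb)) := hw₀.2
    have h4 : entrySum (0 : OneBody Nb) = 0 := by simp [entrySum]
    rw [h2, sub_self, h4] at h3
    exact absurd hε (not_lt.2 h3)
  filter_upwards [eventually_uniformlyFractional hδ hγ, eventually_entrySum_lt hm]
    with h hh hhm w hw hwγ
  by_contra hcon
  rw [← hwγ] at hh
  -- The 1RDM of w is still uniformly fractional, so w is bounded and would lie in S, though its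
  -- 1RDM is closer than m.
  have h1 := hmS ⟨w, hw⟩ ⟨mem_closedBall_zero_iff.2 (hR ⟨w, hw⟩ hh), not_lt.1 hcon⟩
  simp only [hwγ, add_sub_cancel_left] at h1
  linarith

theorem hasDerivAlong_universalFunctional (hNb : 1 ≤ Nb) (hN : 1 ≤ N)
    (hs : s = Statistics.fermion → N < Nb) (hβ : 0 < β) (hH₀ : IsSelfAdjoint H₀)
    {v : OneBody Nb} (hv : v ∈ traceless Nb) :
    HasDerivAlong (universalFunctional H₀ β) (tracePairing (-v)) (rdm (gibbs H₀ β v)) := by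
  have := nontrivial_nParticle (s := s) hNb hs
  obtain ⟨δ, hδ, hγ⟩ := exists_uniformlyFractional hNb
    (rdm_gibbs_mem_fractionalRDMs (β := β) hNb hN hs hH₀ hv)
  have hUF := eventually_uniformlyFractional hδ hγ
  refine HasDerivAlong.of_abs_le ?_ fun ε hε => ?_
  · filter_upwards [hUF] with h hh
    obtain ⟨w, hw, hwγ⟩ := exists_rdm_gibbs_eq hNb hs hβ hH₀ (half_pos hδ) hh
    rw [← hwγ, universalFunctional_rdm_gibbs hβ hH₀ hw.1]
    exact ⟨EReal.coe_ne_top _, EReal.coe_ne_bot _⟩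
  filter_upwards [hUF, eventually_entrySum_sub_lt hNb hN hs hβ hH₀ hv hδ hγ hε] with h hh hcl
  obtain ⟨w, hw, hwγ⟩ := exists_rdm_gibbs_eq hNb hs hβ hH₀ (half_pos hδ) hh
  -- The supergradient at w gives nonnegativity of F[γ+h] - F[γ] + tr(vh); the one at v gives the
  -- upper bound tr((v-w)h), at most ε‖h‖ by closeness of w to v.
  have h1 := freeEnergy_le_add hβ hH₀ hw.1 hv.1
  have h2 := freeEnergy_le_add hβ hH₀ hv.1 hw.1
  have h3 := (re_trace_mul_le (v - w) h).trans
    (mul_le_mul_of_nonneg_right (hcl w hw hwγ).le (norm_nonneg h))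
  rw [universalFunctional_rdm_gibbs hβ hH₀ hv.1, ← hwγ,
    universalFunctional_rdm_gibbs hβ hH₀ hw.1, EReal.toReal_coe, EReal.toReal_coe,
    tracePairing_apply]
  rw [hwγ] at h1 ⊢
  simp only [Matrix.sub_mul, Matrix.mul_add, Matrix.neg_mul, Matrix.trace_sub, Matrix.trace_add,
    Matrix.trace_neg, Complex.sub_re, Complex.add_re, Complex.neg_re] at h1 h2 h3 ⊢
  rw [abs_of_nonneg (by linarith)]
  linarith

theorem fractionalRDMs_subset_closedRDMs : fractionalRDMs s Nb N ⊆ closedRDMs s Nb N := by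
  intro γ hγ
  refine ⟨hγ.1.posSemidef, hγ.2.1, ?_⟩
  cases s with
  | boson => trivial
  | fermion => exact hγ.2.2.posSemidef

end Main

end RDMFT

end

open RDMFT in
theorem mainTheorem1 (s : Statistics) (Nb N : ℕ) (hNb : 1 ≤ Nb) (hN : 1 ≤ N)
    (hs : s = Statistics.fermion → N < Nb) (β : ℝ) (hβ : 0 < β)
    (H₀ : Operator s Nb N) (hH₀ : IsSelfAdjoint H₀) :
    fractionalRDMs s Nb N = vRepresentable H₀ β ∧
      (∀ γ ∈ fractionalRDMs s Nb N,
        ∃ J : traceless Nb →L[ℝ] ℝ, HasDerivAlong (universalFunctional H₀ β) J γ) ∧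
      (∀ v ∈ traceless Nb,
        HasDerivAlong (universalFunctional H₀ β) (tracePairing (-v)) (rdm (gibbs H₀ β v))) := by
  have hex : ∀ γ ∈ fractionalRDMs s Nb N, ∃ v ∈ traceless Nb, rdm (gibbs H₀ β v) = γ := by
    intro γ hγ
    obtain ⟨δ, hδ, h⟩ := exists_uniformlyFractional hNb hγ
    exact exists_rdm_gibbs_eq hNb hs hβ hH₀ hδ h
  refine ⟨Set.Subset.antisymm 
    (fun γ hγ => ⟨fractionalRDMs_subset_closedRDMs hγ, hex γ hγ⟩) ?_, ?_, ?_⟩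
  · rintro γ ⟨-, v, hv, rfl⟩
    exact rdm_gibbs_mem_fractionalRDMs hNb hN hs hH₀ hv
  · intro γ hγ
    obtain ⟨v, hv, rfl⟩ := hex γ hγ
    exact ⟨_, hasDerivAlong_universalFunctional hNb hN hs hβ hH₀ hv⟩
  · exact fun v hv => hasDerivAlong_universalFunctional hNb hN hs hβ hH₀ hv
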